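/- **Setting.** Let $V$ be a set of $n$ observed variables and let $1,\dots,M$ be entities. Entity $i$ has a causal DAG $\mathcal D_i$ over $V\cup L_i$, where $L_i$ is a finite set of latent variables, an observational distribution, and for each $w\in V$ an interventional distribution of the atomic intervention $\mathrm{do}(w)$. The causal Markov condition and faithfulness hold, for the observational distribution with respect to $\mathcal D_i$, and for $\mathrm{do}(w)$ with respect to $\mathcal D_i$ with all edges into $w$ removed. Let $\mathcal M_i$ be the maximal ancestral graph (MAG) of $\mathcal D_i$ on $V$: distinct $u,v\in V$ are adjacent iff there is an inducing path between them relative to $L_i$ in $\mathcal D_i$ (a path on which every node not in $L_i$, except for the endpoints, is a collider, and every collider is an ancestor of an endpoint); the edge is $u\to v$ if $u$ is an ancestor of $v$ in $\mathcal D_i$, $u\leftarrow v$ if $v$ is an ancestor of $u$, and $u\leftrightarrow v$ otherwise. The node-distance $d(\mathcal M_i,\mathcal M_j)$ is the number of $u\in V$ whose sets of incident edges (neighbours together with the type of the edge) differ in $\mathcal M_i$ and $\mathcal M_j$. The MAGs satisfy the $\alpha$-clustering property with true clusters $C^\star_1,\dots,C^\star_k$ if these partition $\{1,\dots,M\}$,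 $d(\mathcal M_i,\mathcal M_j)=0$ for $i,j$ in the same cluster, and $d(\mathcal M_i,\mathcal M_j)\ge\alpha n$ for $i,j$ in different clusters. Let $\Delta$ be the maximum undirected degree of $\mathcal M_1,\dots,\mathcal M_M$. A randomized adaptive algorithm accesses an entity only through the answers of conditional independence tests $u\perp v\mid Z$ on its observational distribution (which are free) and $u\perp v\mid Z,\mathrm{do}(w)$ on its interventional distributions; the number of atomic interventions used by the entity is the number of distinct $w$ for which $\mathrm{do}(w)$ is used. **Theorem.** For every constant $c>0$ there is a constant $C>0$, depending only on $c$, such that the following holds for all finite $V$ with $|V|=n$, all $M$, $0<\alpha\le1$ and $0<\delta<1$, where $M\ge2$ or $\delta\le\frac12$. There is a randomized algorithm, which depends only on $V,M,\alpha,\delta$ and $c$, such that for all entities $1,\dots,M$ as above whose MAGs satisfy the $\alpha$-clustering property with true clusters $C^\star_1,\dots,C^\star_k$ with $\min_{b}|C^\star_b|\ge c\,n\log(M/\delta)$, the algorithm outputs exactly $(\mathcal M_1,\dots,\mathcal M_M)$ with probability at least $1-\delta$, and in every run every entity uses at most $$\min\left\{C\,\frac{\Delta\log(M/\delta)}{\alpha},\;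 C\left(\frac{\log(M/\delta)}{\alpha}+k^2\right)\right\}$$ atomic interventions. -/

import Mathlib

open MeasureTheory ProbabilityTheory

namespace CollabCausal

/-! ### Causal DAGs, paths, d-separation -/

/-- A directed acyclic graph on the node set `N`. -/
structure DAG (N : Type*) where
  /-- `edge a b` means `a → b`. -/
  edge : N → N → Prop
  acyclic : ∀ a, ¬ Relation.TransGen edge a a

namespace DAG

variable {N : Type*}

/-- `a` is an ancestor of `b`: `a = b` or there is a directed path from `a` to `b`. -/
def IsAncestor (D : DAG N) (a b : N) : Prop :=
  Relation.ReflTransGen D.edge a b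

/-- `a` and `b` are joined by an edge, in either direction. -/
def Adj (D : DAG N) (a b : N) : Prop :=
  D.edge a b ∨ D.edge b a

/-- `p` lists the (distinct) nodes of an undirected path from `a` to `b`. -/
def IsPath (D : DAG N) (a b : N) (p : List N) : Prop :=
  p.head? = some a ∧ p.getLast? = some b ∧ p.Nodup ∧ p.IsChain D.Adj

/-- In the consecutive triple `a, w, b` of a path, both edges point into `w`. -/
def IsCollider (D : DAG N) (a w b : N) : Prop :=
  D.edge a w ∧ D.edge b w

/-- The path `p` is connecting (not blocked) relative to `Z`: no non-collider on `p` is in `Z`,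
and each collider on `p` is an ancestor of a member of `Z`. -/
def IsConnecting (D : DAG N) (Z : Set N) (p : List N) : Prop :=
  ∀ a w b, [a, w, b] <:+: p →
    (¬ D.IsCollider a w b → w ∉ Z) ∧ (D.IsCollider a w b → ∃ z ∈ Z, D.IsAncestor w z)

/-- `a` and `b` are d-separated by `Z`. -/
def DSep (D : DAG N) (a b : N) (Z : Set N) : Prop :=
  ¬ ∃ p, D.IsPath a b p ∧ D.IsConnecting Z p

/-- `p` is an inducing path between `a` and `b` relative to `L`: every node of `p` outside `L`,
except for the endpoints, is a collider on `p`, and every collider on `p` is an ancestor of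
an endpoint. -/
def IsInducingPath (D : DAG N) (L : Set N) (a b : N) (p : List N) : Prop :=
  D.IsPath a b p ∧
    ∀ x w y, [x, w, y] <:+: p →
      (w ∉ L → D.IsCollider x w y) ∧
        (D.IsCollider x w y → D.IsAncestor w a ∨ D.IsAncestor w b)

/-- The graph after an intervention on `t`: all edges into `t` are removed. -/
def mutilate (D : DAG N) (t : N) : DAG N where
  edge a b := D.edge a b ∧ b ≠ t
  acyclic a h := D.acyclic a (Relation.TransGen.mono (fun _ _ h' => And.left h') a a h)

theorem IsInducingPath.reverse {D : DAG N} {L : Set N} {a b : N} {p : List N}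
    (h : D.IsInducingPath L a b p) : D.IsInducingPath L b a p.reverse := by
  obtain ⟨⟨h1, h2, h3, h4⟩, h5⟩ := h
  refine ⟨⟨by simpa using h2, by simpa using h1, by simpa using h3, ?_⟩, ?_⟩
  · rw [List.isChain_reverse]
    exact h4.imp fun x y hxy => hxy.symm
  · intro x w y hxy
    have := h5 y w x (by simpa using List.reverse_infix.2 hxy)
    exact ⟨fun hw => (this.1 hw).symm, fun hc => (this.2 hc.symm).symm⟩

end DAG

/-! ### Mixed graphs, and the MAG of a DAG with latent nodes -/

/-- A mixed graph with directed and bidirected edges. -/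
@[ext]
structure MixedGraph (V : Type*) where
  /-- `dir u v` means `u → v`. -/
  dir : V → V → Prop
  /-- `bi u v` means `u ↔ v`. -/
  bi : V → V → Prop
  bi_symm : ∀ u v, bi u v → bi v u

/-- The MAG over the observed nodes `V` of a DAG over `V ∪ L`: two distinct observed nodes are
adjacent iff there is an inducing path between them relative to `L`; an edge between adjacent
nodes is `u → v` if `u` is an ancestor of `v` in the DAG, and `u ↔ v` if neither node is an
ancestor of the other one. -/
def DAG.toMAG {V L : Type*} (D : DAG (V ⊕ L)) : MixedGraph V where
  dir u v := u ≠ v ∧ (∃ p, D.IsInducingPath (Set.range Sum.inr) (.inl u) (.inl v) p) ∧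
    D.IsAncestor (.inl u) (.inl v)
  bi u v := u ≠ v ∧ (∃ p, D.IsInducingPath (Set.range Sum.inr) (.inl u) (.inl v) p) ∧
    ¬ D.IsAncestor (.inl u) (.inl v) ∧ ¬ D.IsAncestor (.inl v) (.inl u)
  bi_symm := by
    rintro u v ⟨h1, ⟨p, hp⟩, h2, h3⟩
    exact ⟨h1.symm, ⟨p.reverse, hp.reverse⟩, h3, h2⟩

/-- The possible types of an entry of an incidence set. -/
inductive EdgeType
  | tail
  | head
  | bidirected

namespace MixedGraph

variable {V : Type*}

/-- The incidence set of `u`: `(v, tail)` for `u → v`, `(v, head)` for `u ← v`, and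
`(v, bidirected)` for `u ↔ v`. -/
def incidence (G : MixedGraph V) (u : V) : Set (V × EdgeType) :=
  {e | (e.2 = .tail ∧ G.dir u e.1) ∨ (e.2 = .head ∧ G.dir e.1 u) ∨
    (e.2 = .bidirected ∧ G.bi u e.1)}

/-- The node-difference set of two mixed graphs. -/
def nodeDiff (G H : MixedGraph V) : Set V :=
  {u | G.incidence u ≠ H.incidence u}

/-- The node-distance of two mixed graphs. -/
noncomputable def nodeDist (G H : MixedGraph V) : ℕ :=
  (G.nodeDiff H).ncard

end MixedGraph

/-- The maximum undirected degree of a finite family of mixed graphs. -/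
noncomputable def maxDegree {V : Type*} [Fintype V] {M : ℕ} (G : Fin M → MixedGraph V) : ℕ :=
  Finset.univ.sup fun i => Finset.univ.sup fun u => ((G i).incidence u).ncard

/-- The partition `P` of the entities witnesses the `(α, β)`-clustering property. -/
def IsClusteringAB {V : Type*} [Fintype V] {M : ℕ} (G : Fin M → MixedGraph V) (α β : ℝ)
    (P : Finpartition (Finset.univ : Finset (Fin M))) : Prop :=
  0 ≤ β ∧ β < α ∧
  (∀ C ∈ P.parts, ∀ i ∈ C, ∀ j ∈ C, ((G i).nodeDist (G j) : ℝ) ≤ β * Fintype.card V) ∧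
  (∀ C ∈ P.parts, ∀ C' ∈ P.parts, C ≠ C' →
    ∀ i ∈ C, ∀ j ∈ C', α * Fintype.card V ≤ (G i).nodeDist (G j))

/-- The partition `P` of the entities witnesses the `α`-clustering property. -/
def IsClustering {V : Type*} [Fintype V] {M : ℕ} (G : Fin M → MixedGraph V) (α : ℝ)
    (P : Finpartition (Finset.univ : Finset (Fin M))) : Prop :=
  IsClusteringAB G α 0 P

/-! ### Entities and conditional independence tests -/

/-- An entity over the observed variables `V`: a causal DAG over the observed and finitely many
latent variables, the observational distribution `law none` of the observed variables, and, for
each `w : V`, the distribution `law (some w)` of the observed variables under the atomic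
intervention on `w`. -/
structure Entity (V : Type*) where
  /-- The number of latent variables. -/
  numLatent : ℕ
  dag : DAG (V ⊕ Fin numLatent)
  law : Option V → ProbabilityMeasure (V → ℝ)

namespace Entity

variable {V : Type*}

/-- The MAG associated with an entity. -/
def mag (E : Entity V) : MixedGraph V :=
  E.dag.toMAG

/-- The causal DAG in a regime: unchanged in the observational one, and mutilated at `w` under an
intervention on `w`. -/
def regimeDAG (E : Entity V) : Option V → DAG (V ⊕ Fin E.numLatent)
  | none => E.dag
  | some w => E.dag.mutilate (.inl w)

/-- The σ-algebra generated by the coordinates in `Z` is coarser than the product σ-algebra. -/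
theorem comap_restrict_le (Z : Finset V) :
    MeasurableSpace.comap (fun (x : V → ℝ) (z : Z) => x z) inferInstance ≤
      (inferInstance : MeasurableSpace (V → ℝ)) :=
  Measurable.comap_le (f := fun (x : V → ℝ) (z : Z) => x z)
    (measurable_pi_lambda _ fun z => measurable_pi_apply (z : V))

/-- The conditional independence test `u ⫫ v | Z` in the observational distribution (`r = none`),
or `u ⫫ v | Z, do(w)` in the interventional distribution of `w` (`r = some w`). -/
def CI [Fintype V] (E : Entity V) (r : Option V) (u v : V) (Z : Finset V) : Prop :=
  CondIndepFun (MeasurableSpace.comap (fun (x : V → ℝ) (z : Z) => x z) inferInstance)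
    (comap_restrict_le Z) (fun x => x u) (fun x => x v) (E.law r : Measure (V → ℝ))

/-- The (global) causal Markov condition for the observational and all interventional
distributions; it is only required of pairs of observed nodes and observed conditioning sets. -/
def IsMarkov [Fintype V] (E : Entity V) : Prop :=
  ∀ (r : Option V) (u v : V) (Z : Finset V), u ≠ v → u ∉ Z → v ∉ Z →
    (E.regimeDAG r).DSep (.inl u) (.inl v) (Sum.inl '' (Z : Set V)) → E.CI r u v Z

/-- Faithfulness of the observational and all interventional distributions; it is only required
of pairs of observed nodes and observed conditioning sets. -/
def IsFaithful [Fintype V] (E : Entity V) : Prop :=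
  ∀ (r : Option V) (u v : V) (Z : Finset V), u ≠ v → u ∉ Z → v ∉ Z →
    E.CI r u v Z → (E.regimeDAG r).DSep (.inl u) (.inl v) (Sum.inl '' (Z : Set V))

end Entity

/-! ### Randomized adaptive algorithms with access to `M` entities through CI-tests -/

/-- A randomized adaptive algorithm over the observed nodes `V` and the entities `Fin M`: it
returns an output, or performs a CI-test on an entity in one of its regimes and continues
according to the answer, or draws a uniformly random number and continues according to it. -/
inductive Algorithm (V : Type*) (M : ℕ) (Out : Type*)
  | ret (out : Out)
  | test (i : Fin M) (r : Option V) (u v : V) (Z : Finset V) (next : Bool → Algorithm V M Out)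
  | sample (m : ℕ) (next : Fin (m + 1) → Algorithm V M Out)

open Classical in
/-- The joint law of the output and of the sets of nodes on which the entities are intervened,
for a run against the entities `E`. An entity is intervened on `w` in a run iff some CI-test of
the run is performed on its interventional distribution of `w`. -/
noncomputable def Algorithm.run {V : Type*} [Fintype V] {M : ℕ} {Out : Type*}
    (E : Fin M → Entity V) : Algorithm V M Out → PMF (Out × (Fin M → Finset V))
  | .ret out => PMF.pure (out, fun _ => ∅)
  | .test i r u v Z next =>
      (run E (next (decide ((E i).CI r u v Z)))).map fun ω =>
        (ω.1, Function.update ω.2 i (ω.2 i ∪ r.toFinset))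
  | .sample m next => (PMF.uniformOfFintype (Fin (m + 1))).bind fun j => run E (next j)

end CollabCausal

open CollabCausal

/-! The algorithm learns the skeletons of all MAGs for free: two observed nodes are joined by an
inducing path iff no set of observed nodes d-separates them (`DAG.IsInducingPath.not_dSep`,
`DAG.isInducingPath_of_isConnecting`). An intervention on `u` reveals the edges out of `u`, since
in the mutilated graph `u` is marginally dependent on exactly its descendants
(`DAG.dSep_mutilate_iff`). The skeleton and the edges out of all nodes determine the MAG.

Each entity is intervened on a constant number `t` of random nodes. As the clusters have at least
`c n log (M / δ)` members, with high probability each node is assigned in this way to some entity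
of each cluster, so that everything about each cluster has been seen; what is missing is which
entities belong together. Entities with different skeletons are apart. If two entities of one class
that has not been told apart so far have been seen to differ at a node `v`, then all entities of
their skeleton class are intervened on `v`. Each such step increases the number of distinct results
in the skeleton class, which is at most the number `k` of clusters, so that there are fewer than `k`
of them (`card_refineList_lt`).

For the bound in terms of the degree, the nodes `v` are taken only from a random set `S` of about
`3 log (M / δ) / α` nodes and the neighbours of `S`; with high probability `S` hits the
node-difference set of any two clusters, and a difference of incident edges shows in the
interventions on the two endpoints of some edge (`exists_children_ne`), so these nodes suffice
to tell the clusters apart (`readOff_refineList_eq`). The same nodes serve both bounds at once.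
Isolated nodes are never intervened on, which settles the case of degree `0`. The failure
probability is estimated by counting (`card_good_ge`). -/


/-! ### d-separation and inducing paths -/

namespace CollabCausal

theorem _root_.List.exists_eq_append_of_not_nodup {N : Type*} {p : List N} (h : ¬ p.Nodup) :
    ∃ w l₁ l₂ l₃, p = l₁ ++ w :: (l₂ ++ w :: l₃) := by
  induction p with
  | nil => simp at h
  | cons a l ih =>
    by_cases ha : a ∈ l
    · obtain ⟨s, t, rfl⟩ := List.append_of_mem ha
      exact ⟨a, [], s, t, rfl⟩
    · obtain ⟨w, l₁, l₂, l₃, rfl⟩ := ih fun hl => h (List.nodup_cons.2 ⟨ha, hl⟩)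
      exact ⟨w, a :: l₁, l₂, l₃, rfl⟩

namespace DAG

variable {N : Type*} {D : DAG N} {Z : Set N} {a b w u v : N} {p q : List N}

theorem edge_asymm (h : D.edge a b) : ¬ D.edge b a := fun h' =>
  D.acyclic a (.tail (.single h) h')

/-- The condition that a connecting path relative to `Z` satisfies at the triple `a, w, b`. -/
def Passes (D : DAG N) (Z : Set N) (a w b : N) : Prop :=
  (¬ D.IsCollider a w b → w ∉ Z) ∧ (D.IsCollider a w b → ∃ z ∈ Z, D.IsAncestor w z)

theorem Passes.symm (h : D.Passes Z a w b) : D.Passes Z b w a :=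
  ⟨fun hn => h.1 fun hc => hn hc.symm, fun hc => h.2 hc.symm⟩

theorem passes_of_edge_left (h : D.edge w a) (hw : w ∉ Z) : D.Passes Z a w b :=
  ⟨fun _ => hw, fun hc => absurd hc.1 (edge_asymm h)⟩

theorem passes_of_edge_right (h : D.edge w b) (hw : w ∉ Z) : D.Passes Z a w b :=
  ⟨fun _ => hw, fun hc => absurd hc.2 (edge_asymm h)⟩

theorem Passes.notMem_of_edge_left (h : D.Passes Z a w b) (hw : D.edge w a) : w ∉ Z :=
  h.1 fun hc => edge_asymm hw hc.1

theorem IsConnecting.mono (h : D.IsConnecting Z p) (hq : q <:+: p) : D.IsConnecting Z q :=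
  fun a w b hi => h a w b (hi.trans hq)

theorem IsConnecting.reverse (h : D.IsConnecting Z p) : D.IsConnecting Z p.reverse :=
  fun a w b hi => Passes.symm (h b w a (by simpa using List.reverse_infix.2 hi))

theorem isConnecting_cons_cons_cons {l : List N} :
    D.IsConnecting Z (a :: w :: b :: l) ↔ D.Passes Z a w b ∧ D.IsConnecting Z (w :: b :: l) := by
  refine ⟨fun h => ⟨h a w b ⟨[], l, rfl⟩, h.mono ⟨[a], [], by simp⟩⟩, fun ⟨h1, h2⟩ x y z hi => ?_⟩
  rcases List.infix_cons_iff.1 hi with hp | hi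
  · obtain ⟨t, ht⟩ := hp
    simp only [List.cons_append, List.nil_append, List.cons.injEq] at ht
    obtain ⟨rfl, rfl, rfl, -⟩ := ht
    exact h1
  · exact h2 x y z hi

theorem isConnecting_of_length_le (h : p.length ≤ 2) : D.IsConnecting Z p := by
  intro a w b hi
  have := hi.length_le
  simp at this
  omega

theorem isConnecting_append_cons {l₁ l₃ : List N} (h₁ : D.IsConnecting Z (l₁ ++ [w]))
    (h₃ : D.IsConnecting Z (w :: l₃))
    (h : ∀ a ∈ l₁.getLast?, ∀ b ∈ l₃.head?, D.Passes Z a w b) :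
    D.IsConnecting Z (l₁ ++ w :: l₃) := by
  induction l₁ with
  | nil => exact h₃
  | cons a l ih =>
    cases l with
    | nil =>
      cases l₃ with
      | nil => exact h₁
      | cons b l₃ => exact isConnecting_cons_cons_cons.2 ⟨h a (by simp) b (by simp), h₃⟩
    | cons a' l =>
      have ih' := ih (h₁.mono ⟨[a], [], by simp⟩) (by simpa using h)
      cases l with
      | nil =>
        exact isConnecting_cons_cons_cons.2 ⟨h₁ a a' w ⟨[], [], by simp⟩, ih'⟩
      | cons a'' l =>
        exact isConnecting_cons_cons_cons.2 ⟨h₁ a a' a'' ⟨[], l ++ [w], by simp⟩, ih'⟩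

/-- A connecting path that leaves `w` along an edge out of `w` stays directed until it meets a
collider, which is an ancestor of a member of `Z`, or until it ends. -/
theorem ancestor_or_transGen_of_isConnecting (l : List N) {w b : N} (hwb : D.edge w b)
    (hl : (w :: b :: l).IsChain D.Adj) (hc : D.IsConnecting Z (w :: b :: l)) :
    (∃ z ∈ Z, D.IsAncestor w z) ∨
      Relation.TransGen D.edge w ((b :: l).getLast (by simp)) := by
  induction l generalizing w b with
  | nil => exact .inr (.single hwb)
  | cons y l ih =>
    obtain ⟨h1, h2⟩ := isConnecting_cons_cons_cons.1 hc
    have hl' := (List.isChain_cons_cons.1 hl).2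
    rcases (List.isChain_cons_cons.1 hl').1 with hby | hyb
    · rcases ih hby hl' h2 with ⟨z, hz, h⟩ | h
      · exact .inl ⟨z, hz, .head hwb h⟩
      · exact .inr (by simpa using Relation.TransGen.head hwb h)
    · obtain ⟨z, hz, h⟩ := h1.2 ⟨hwb, hyb⟩
      exact .inl ⟨z, hz, .head hwb h⟩

/-- Removing the detours from a connecting walk makes it a path. The delicate case is a node `w`
that becomes a collider when the detour from `w` back to `w` is cut out: the detour cannot be
directed throughout, by acyclicity, so `w` is an ancestor of a collider on it. -/
theorem exists_isPath_of_walk (h₁ : p.head? = some a) (h₂ : p.getLast? = some b)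
    (h₃ : p.IsChain D.Adj) (h₄ : D.IsConnecting Z p) :
    ∃ q, D.IsPath a b q ∧ D.IsConnecting Z q := by
  induction hn : p.length using Nat.strong_induction_on generalizing p with
  | _ n ih =>
    by_cases hd : p.Nodup
    · exact ⟨p, ⟨h₁, h₂, hd, h₃⟩, h₄⟩
    obtain ⟨w, l₁, l₂, l₃, rfl⟩ := List.exists_eq_append_of_not_nodup hd
    subst hn
    have hs := List.isChain_split.1 h₃
    have hs' := (List.isChain_split (l₁ := w :: l₂)).1 (by simpa using hs.2)
    refine ih (l₁ ++ w :: l₃).length (by simp) (p := l₁ ++ w :: l₃) ?_ ?_ ?_ ?_ rfl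
    · cases l₁ <;> simpa using h₁
    · rw [← h₂]
      simp [List.getLast?_append, List.getLast?_cons]
    · exact List.isChain_split.2 ⟨hs.1, hs'.2⟩
    · refine isConnecting_append_cons (h₄.mono ⟨[], l₂ ++ w :: l₃, by simp⟩)
        (h₄.mono ⟨l₁ ++ w :: l₂, [], by simp⟩) fun x hx y hy => ?_
      obtain ⟨m₁, rfl⟩ : ∃ m, l₁ = m ++ [x] := List.getLast?_eq_some_iff.1 hx
      obtain ⟨m₃, rfl⟩ : ∃ m, l₃ = y :: m := List.head?_eq_some_iff.1 hy
      -- the nodes after the first and before the second occurrence of `w`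
      obtain ⟨c, m, hcm⟩ : ∃ c m, l₂ ++ [w] = c :: m := by cases l₂ <;> simp
      have hpc : D.Passes Z x w c := h₄ x w c ⟨m₁, m ++ y :: m₃, by
        have : l₂ ++ w :: y :: m₃ = (l₂ ++ [w]) ++ y :: m₃ := by simp
        simp [this, hcm]⟩
      obtain ⟨d, m', hdm⟩ : ∃ d m, w :: l₂ = m ++ [d] :=
        ⟨_, _, (List.dropLast_append_getLast (l := w :: l₂) (by simp)).symm⟩
      have hpd : D.Passes Z y w d := Passes.symm (h₄ d w y ⟨m₁ ++ [x] ++ m', m₃, by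
        have : w :: (l₂ ++ w :: y :: m₃) = (w :: l₂) ++ w :: y :: m₃ := by simp
        rw [this, hdm]; simp⟩)
      rcases (List.isChain_append_cons_cons.1 (by simpa using hs.1 :
        (m₁ ++ x :: w :: []).IsChain D.Adj)).2.1 with hxw | hwx
      · rcases (List.isChain_cons_cons.1 hs'.2).1 with hwy | hyw
        · exact passes_of_edge_right hwy (hpd.notMem_of_edge_left hwy)
        · refine ⟨fun hn => absurd ⟨hxw, hyw⟩ hn, fun _ => ?_⟩
          have hch : (w :: c :: m).IsChain D.Adj := by
            rw [← hcm]; simpa using hs'.1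
          have hco : D.IsConnecting Z (w :: c :: m) :=
            h₄.mono ⟨m₁ ++ [x], y :: m₃, by rw [← hcm]; simp⟩
          rcases (List.isChain_cons_cons.1 hch).1 with hwc | hcw
          · rcases ancestor_or_transGen_of_isConnecting m hwc hch hco with h | h
            · exact h
            · have : (c :: m).getLast (by simp) = w := by simp [← hcm]
              exact absurd (this ▸ h) (D.acyclic w)
          · exact hpc.2 ⟨hxw, hcw⟩
      · exact passes_of_edge_left hwx (hpc.notMem_of_edge_left hwx)

/-- A connecting walk, written backwards with `y` as its current end, can be prolonged along a
directed path from `y` to `t`, provided that `y` is not an ancestor of a member of `Z`. -/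
theorem exists_append_of_isAncestor {y t : N} (hyt : D.IsAncestor y t)
    (hy : ¬ ∃ z ∈ Z, D.IsAncestor y z) {q : List N} (hch : (y :: q).IsChain D.Adj)
    (hco : D.IsConnecting Z (y :: q)) :
    ∃ r, (r ++ y :: q).head? = some t ∧ (r ++ y :: q).IsChain D.Adj ∧
      D.IsConnecting Z (r ++ y :: q) := by
  induction hyt using Relation.ReflTransGen.head_induction_on generalizing q with
  | refl => exact ⟨[], rfl, hch, hco⟩
  | head h _ ih =>
    rename_i y y' _
    have hyZ : y ∉ Z := fun hz => hy ⟨y, hz, .refl⟩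
    have hco' : D.IsConnecting Z (y' :: y :: q) := by
      cases q with
      | nil => exact isConnecting_of_length_le (by simp)
      | cons x q => exact isConnecting_cons_cons_cons.2 ⟨passes_of_edge_left h hyZ, hco⟩
    obtain ⟨r, h1, h2, h3⟩ := ih (q := y :: q)
      (fun ⟨z, hz, hyz⟩ => hy ⟨z, hz, .head h hyz⟩)
      (List.isChain_cons_cons.2 ⟨.inr h, hch⟩) hco'
    exact ⟨r ++ [y'], by simpa using h1, by simpa using h2, by simpa using h3⟩

/-- A path from `u` to `v` connects relative to every `Z` as soon as its non-colliders avoid `Z`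
and its colliders are ancestors of `u`, of `v`, or of `Z`: at a collider that is not an ancestor of
`Z`, reroute the walk along a directed path, back to `u` or ahead to `v`. -/
theorem exists_connecting_of_colliders {l : List N}
    (hch : (u :: l).IsChain D.Adj) (hl : (u :: l).getLast? = some v)
    (h : ∀ a w b, [a, w, b] <:+: u :: l → (¬ D.IsCollider a w b → w ∉ Z) ∧
      (D.IsCollider a w b → D.IsAncestor w u ∨ D.IsAncestor w v)) :
    ∃ q, D.IsPath u v q ∧ D.IsConnecting Z q := by
  -- walk along the path; `y :: x :: q` is a connecting walk from `u`, written backwards, whose last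
  -- step `x, y` is a step of the path, and `l` is the rest of the path
  suffices key : ∀ (l q : List N) (x y : N), (x :: y :: l).IsChain D.Adj →
      (x :: y :: l).getLast? = some v →
      (∀ a w b, [a, w, b] <:+: x :: y :: l → (¬ D.IsCollider a w b → w ∉ Z) ∧
        (D.IsCollider a w b → D.IsAncestor w u ∨ D.IsAncestor w v)) →
      (y :: x :: q).getLast? = some u → (y :: x :: q).IsChain D.Adj →
      D.IsConnecting Z (y :: x :: q) →
      ∃ q, D.IsPath u v q ∧ D.IsConnecting Z q by
    cases l with
    | nil =>
      exact exists_isPath_of_walk rfl hl hch (isConnecting_of_length_le (by simp))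
    | cons y l =>
      refine key l [] u y hch hl h rfl ?_ (isConnecting_of_length_le (by simp))
      exact List.isChain_pair.2 (List.isChain_cons_cons.1 hch).1.symm
  intro l
  have finish : ∀ q : List N, q.head? = some v → q.getLast? = some u → q.IsChain D.Adj →
      D.IsConnecting Z q → ∃ q, D.IsPath u v q ∧ D.IsConnecting Z q := fun q h1 h2 h3 h4 =>
    exists_isPath_of_walk (p := q.reverse) (by simpa using h2) (by simpa using h1)
      (List.isChain_reverse.2 (h3.imp fun _ _ => Or.symm)) h4.reverse
  induction l with
  | nil =>
    intro q x y _ hl _ hqu hq hqc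
    exact finish _ (by simpa using hl) hqu hq hqc
  | cons z l ih =>
    intro q x y hch hl h hqu hq hqc
    have hxyz := h x y z ⟨[], l, rfl⟩
    have hyz := (List.isChain_cons_cons.1 (List.isChain_cons_cons.1 hch).2).1
    have step := fun q => ih q y z (List.isChain_cons_cons.1 hch).2 (by simpa using hl)
      fun a w b hi => h a w b (hi.trans ⟨[x], [], by simp⟩)
    have ext (hp : D.Passes Z x y z) : ∃ q, D.IsPath u v q ∧ D.IsConnecting Z q :=
      step (x :: q) (by simpa using hqu) (List.isChain_cons_cons.2 ⟨hyz.symm, hq⟩)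
        (isConnecting_cons_cons_cons.2 ⟨hp.symm, hqc⟩)
    by_cases hcol : D.IsCollider x y z
    · by_cases hyZ : ∃ z ∈ Z, D.IsAncestor y z
      · exact ext ⟨fun hn => absurd hcol hn, fun _ => hyZ⟩
      rcases hxyz.2 hcol with hyu | hyv
      · obtain ⟨r, h1, h2, h3⟩ := exists_append_of_isAncestor hyu hyZ (q := [z])
          (List.isChain_pair.2 hyz) (isConnecting_of_length_le (by simp))
        refine step r.reverse ?_ ?_ ?_
        · have : z :: y :: r.reverse = (r ++ [y, z]).reverse := by simp
          rw [this, List.getLast?_reverse, h1]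
        · have : z :: y :: r.reverse = (r ++ [y, z]).reverse := by simp
          rw [this]
          exact List.isChain_reverse.2 (h2.imp fun _ _ => Or.symm)
        · have : z :: y :: r.reverse = (r ++ [y, z]).reverse := by simp
          rw [this]
          exact h3.reverse
      · obtain ⟨r, h1, h2, h3⟩ := exists_append_of_isAncestor hyv hyZ hq hqc
        exact finish _ h1 (by simpa [List.getLast?_append] using hqu) h2 h3
    · exact ext ⟨hxyz.1, fun hc => absurd hc hcol⟩

/-- Nodes joined by an inducing path relative to `L` are not d-separated by any set of nodes
outside `L`. -/
theorem IsInducingPath.not_dSep {L : Set N} (h : D.IsInducingPath L u v p) (hZ : Disjoint Z L) :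
    ¬ D.DSep u v Z := by
  obtain ⟨⟨h1, h2, -, h4⟩, h5⟩ := h
  obtain ⟨l, rfl⟩ := List.head?_eq_some_iff.1 h1
  refine not_not.2 (exists_connecting_of_colliders h4 h2 fun a w b hi => ⟨fun hn hw => ?_,
    (h5 a w b hi).2⟩)
  exact hn ((h5 a w b hi).1 fun hL => Set.disjoint_left.1 hZ hw hL)

/-- On a path that connects relative to `Z`, a node that is not a collider is an ancestor of an
endpoint or of a member of `Z`. -/
theorem IsPath.isAncestor_of_not_isCollider (hp : D.IsPath u v p) (hc : D.IsConnecting Z p)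
    (hi : [a, w, b] <:+: p) (hn : ¬ D.IsCollider a w b) :
    D.IsAncestor w u ∨ D.IsAncestor w v ∨ ∃ z ∈ Z, D.IsAncestor w z := by
  obtain ⟨h1, h2, -, h4⟩ := hp
  obtain ⟨s, t, rfl⟩ := hi
  have hch : (s ++ a :: w :: b :: t).IsChain D.Adj := by simpa using h4
  have hch' := List.isChain_append_cons_cons.1 hch
  have hwb := (List.isChain_cons_cons.1 hch'.2.2).1
  have htwo : D.edge w a ∨ D.edge w b := by
    by_contra! h
    exact hn ⟨hch'.2.1.resolve_right h.1, hwb.resolve_left h.2⟩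
  rcases htwo with h | h
  · have hrev : (w :: a :: s.reverse) <:+: (s ++ [a, w, b] ++ t).reverse :=
      ⟨t.reverse ++ [b], [], by simp⟩
    have hc' := hc.reverse.mono hrev
    have hch'' : (w :: a :: s.reverse).IsChain D.Adj :=
      List.IsChain.infix (List.isChain_reverse.2 (h4.imp fun _ _ => Or.symm)) hrev
    rcases ancestor_or_transGen_of_isConnecting _ h hch'' hc' with h | h
    · exact .inr (.inr h)
    · refine .inl ?_
      have : (a :: s.reverse).getLast (by simp) = u := by
        have h1' : (a :: s.reverse).getLast? = some u := by
          rw [← h1]; cases s <;> simp [List.getLast?_cons]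
        rw [List.getLast?_eq_some_getLast (by simp)] at h1'
        simpa using h1'
      exact this ▸ h.to_reflTransGen
  · rcases ancestor_or_transGen_of_isConnecting t h hch'.2.2
      (hc.mono ⟨s ++ [a], [], by simp⟩) with h | h
    · exact .inr (.inr h)
    · refine .inr (.inl ?_)
      have : (b :: t).getLast (by simp) = v := by
        have h1' : (b :: t).getLast? = some v := by
          rw [← h2]; simp [List.getLast?_append, List.getLast?_cons]
        rw [List.getLast?_eq_some_getLast (by simp)] at h1'
        simpa using h1'
      exact this ▸ h.to_reflTransGen

/-- Relative to the observed proper ancestors of `u` and `v`, every connecting path between `u`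
and `v` is inducing. -/
theorem isInducingPath_of_isConnecting {L : Set N} (hp : D.IsPath u v p)
    (hc : D.IsConnecting {x | x ∉ L ∧ x ≠ u ∧ x ≠ v ∧ (D.IsAncestor x u ∨ D.IsAncestor x v)} p) :
    D.IsInducingPath L u v p := by
  have hanc : ∀ w, (∃ z ∈ {x | x ∉ L ∧ x ≠ u ∧ x ≠ v ∧ (D.IsAncestor x u ∨ D.IsAncestor x v)},
      D.IsAncestor w z) → D.IsAncestor w u ∨ D.IsAncestor w v := by
    rintro w ⟨z, ⟨-, -, -, hz⟩, hwz⟩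
    exact hz.imp hwz.trans hwz.trans
  refine ⟨hp, fun x w y hi => ⟨fun hwL => ?_, fun hcol => hanc w ((hc x w y hi).2 hcol)⟩⟩
  by_contra hn
  have hw : D.IsAncestor w u ∨ D.IsAncestor w v := by
    rcases hp.isAncestor_of_not_isCollider hc hi hn with h | h | h
    · exact .inl h
    · exact .inr h
    · exact hanc w h
  obtain ⟨h1, h2, h3, -⟩ := hp
  obtain ⟨s, t, rfl⟩ := hi
  refine (hc x w y ⟨s, t, rfl⟩).1 hn ⟨hwL, ?_, ?_, hw⟩
  · rintro rfl
    cases s with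
    | nil =>
      obtain rfl : x = w := by simpa using h1
      simp at h3
    | cons c s =>
      obtain rfl : c = w := by simpa using h1
      simp at h3
  · rintro rfl
    rcases List.eq_nil_or_concat t with rfl | ⟨t, c, rfl⟩
    · obtain rfl : y = w := by simpa [List.getLast?_append] using h2
      simp [List.nodup_append] at h3
    · obtain rfl : c = w := by
        rw [List.concat_eq_append, ← List.append_assoc, List.getLast?_concat] at h2
        simpa using h2
      simp [List.nodup_append] at h3

/-- Under an intervention on `w`, the node `w` is d-separated by `∅` from exactly the nodes that it
is not an ancestor of. -/
theorem dSep_mutilate_iff (hwu : w ≠ u) :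
    (D.mutilate w).DSep w u ∅ ↔ ¬ D.IsAncestor w u := by
  rw [DSep, not_iff_not]
  constructor
  · rintro ⟨p, ⟨h1, h2, -, h4⟩, hc⟩
    obtain ⟨l, rfl⟩ := List.head?_eq_some_iff.1 h1
    cases l with
    | nil => exact absurd (by simpa using h2) hwu
    | cons b l =>
      rcases (List.isChain_cons_cons.1 h4).1 with h | h
      · rcases ancestor_or_transGen_of_isConnecting l h h4 hc with ⟨z, hz, -⟩ | h
        · exact absurd hz (by simp)
        · have : (b :: l).getLast (by simp) = u := by
            rw [List.getLast?_cons_cons, List.getLast?_eq_some_getLast (by simp)] at h2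
            simpa using h2
          have h' := this ▸ h.to_reflTransGen
          exact Relation.ReflTransGen.mono (p := D.edge) (fun _ _ h => And.left h) _ _ h'
      · exact absurd rfl h.2
  · intro h
    have h' : (D.mutilate w).IsAncestor w u := by
      clear hwu
      induction h with
      | refl => exact .refl
      | tail h1 h2 ih =>
        refine ih.tail ⟨h2, ?_⟩
        rintro rfl
        exact D.acyclic _ (Relation.TransGen.tail' h1 h2)
    obtain ⟨r, h1, h2, h3⟩ := exists_append_of_isAncestor (Z := ∅) h' (by simp) (q := [])
      (List.isChain_singleton _) (isConnecting_of_length_le (by simp))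
    exact exists_isPath_of_walk (p := (r ++ [w]).reverse) (by simp)
      (by rw [List.getLast?_reverse, h1]) (List.isChain_reverse.2 (h2.imp fun _ _ => Or.symm))
      h3.reverse

end DAG

/-! ### Identification of the MAG from conditional independence tests -/

/-- Adjacency in a mixed graph, by an edge of any type. -/
def MixedGraph.Adj {V : Type*} (G : MixedGraph V) (u v : V) : Prop :=
  G.dir u v ∨ G.dir v u ∨ G.bi u v

/-- The children of `u` in a mixed graph. -/
def MixedGraph.children {V : Type*} (G : MixedGraph V) (u : V) : Set V :=
  {v | G.dir u v}

namespace Entity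

variable {V : Type*} {E : Entity V}

theorem mag_adj_iff (u v : V) : E.mag.Adj u v ↔
    u ≠ v ∧ ∃ p, E.dag.IsInducingPath (Set.range Sum.inr) (.inl u) (.inl v) p := by
  constructor
  · rintro (⟨h, hp, -⟩ | ⟨h, ⟨p, hp⟩, -⟩ | ⟨h, hp, -⟩)
    · exact ⟨h, hp⟩
    · exact ⟨h.symm, _, hp.reverse⟩
    · exact ⟨h, hp⟩
  · rintro ⟨h, p, hp⟩
    by_cases h1 : E.dag.IsAncestor (.inl u) (.inl v)
    · exact .inl ⟨h, ⟨p, hp⟩, h1⟩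
    by_cases h2 : E.dag.IsAncestor (.inl v) (.inl u)
    · exact .inr (.inl ⟨h.symm, ⟨_, hp.reverse⟩, h2⟩)
    · exact .inr (.inr ⟨h, ⟨p, hp⟩, h1, h2⟩)

theorem mag_dir_iff (u v : V) :
    E.mag.dir u v ↔ E.mag.Adj u v ∧ E.dag.IsAncestor (.inl u) (.inl v) := by
  rw [mag_adj_iff, and_assoc]
  rfl

theorem mag_bi_iff (u v : V) :
    E.mag.bi u v ↔ E.mag.Adj u v ∧ ¬ E.mag.dir u v ∧ ¬ E.mag.dir v u := by
  have hs : E.mag.Adj v u ↔ E.mag.Adj u v := by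
    have := E.mag.bi_symm u v
    have := E.mag.bi_symm v u
    unfold MixedGraph.Adj
    tauto
  rw [mag_dir_iff, mag_dir_iff, hs]
  have : E.mag.bi u v ↔ E.mag.Adj u v ∧ ¬ E.dag.IsAncestor (.inl u) (.inl v) ∧
      ¬ E.dag.IsAncestor (.inl v) (.inl u) := by
    rw [mag_adj_iff, and_assoc]
    rfl
  tauto

variable [Fintype V]

theorem ci_iff_dSep (hM : E.IsMarkov) (hF : E.IsFaithful) (r : Option V) {u v : V} {Z : Finset V}
    (huv : u ≠ v) (hu : u ∉ Z) (hv : v ∉ Z) :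
    E.CI r u v Z ↔ (E.regimeDAG r).DSep (.inl u) (.inl v) (Sum.inl '' (Z : Set V)) :=
  ⟨hF r u v Z huv hu hv, hM r u v Z huv hu hv⟩

/-- Observational tests identify the adjacencies of the MAG. -/
theorem mag_adj_iff_ci (hM : E.IsMarkov) (hF : E.IsFaithful) (u v : V) :
    E.mag.Adj u v ↔ u ≠ v ∧ ∀ Z : Finset V, u ∉ Z → v ∉ Z → ¬ E.CI none u v Z := by
  rw [mag_adj_iff]
  refine and_congr_right fun huv => ⟨fun ⟨p, hp⟩ Z hu hv hci => ?_, fun h => ?_⟩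
  · refine hp.not_dSep (Z := Sum.inl '' (Z : Set V)) ?_ ((ci_iff_dSep hM hF none huv hu hv).1 hci)
    rw [Set.disjoint_left]
    rintro _ ⟨x, -, rfl⟩ ⟨y, hy⟩
    cases hy
  · classical
    -- the observed proper ancestors of `u` and `v` would separate them
    let Z : Finset V := Finset.univ.filter fun x => x ≠ u ∧ x ≠ v ∧
      (E.dag.IsAncestor (.inl x) (.inl u) ∨ E.dag.IsAncestor (.inl x) (.inl v))
    have hu : u ∉ Z := by simp [Z]
    have hv : v ∉ Z := by simp [Z]
    have hZ : (Sum.inl '' (Z : Set V) : Set (V ⊕ Fin E.numLatent)) =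
        {x | x ∉ Set.range Sum.inr ∧ x ≠ .inl u ∧ x ≠ .inl v ∧
          (E.dag.IsAncestor x (.inl u) ∨ E.dag.IsAncestor x (.inl v))} := by
      ext (x | x) <;> simp [Z]
    have hd := mt (ci_iff_dSep hM hF none huv hu hv).2 (h Z hu hv)
    rw [hZ] at hd
    obtain ⟨p, hp, hc⟩ := not_not.1 hd
    exact ⟨p, DAG.isInducingPath_of_isConnecting hp hc⟩

/-- Marginal tests under an intervention on `u` identify the edges out of `u`. -/
theorem mem_children_mag_iff (hM : E.IsMarkov) (hF : E.IsFaithful) (u v : V) :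
    v ∈ E.mag.children u ↔ E.mag.Adj u v ∧ ¬ E.CI (some u) u v ∅ := by
  change E.mag.dir u v ↔ _
  rw [mag_dir_iff]
  refine and_congr_right fun hadj => ?_
  have huv : u ≠ v := ((mag_adj_iff u v).1 hadj).1
  have := DAG.dSep_mutilate_iff (D := E.dag) (w := .inl u) (u := .inl v)
    (fun h => huv (Sum.inl_injective h))
  rw [ci_iff_dSep hM hF (some u) huv (by simp) (by simp)]
  simp only [Finset.coe_empty, Set.image_empty]
  exact (not_iff_comm.1 this.symm).symm

end Entity

/-! ### Refinement of the skeleton classes -/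

/-! In the following, `a i` is the skeleton of the entity `i`, `g i v` is the set of children of `v`
in the MAG of `i`, which is what an intervention on `v` reveals, `R i` is a set of nodes on which
`i` has been intervened, and `S` is a set of nodes that hits the differences of the MAGs. -/

section Refine

variable {ι V : Type*}

open Classical in
/-- The nodes that have a neighbour and are in `S` or next to `S`. -/
noncomputable def candidates [Fintype V] (a : V → V → Prop) (S : Finset V) : Finset V :=
  Finset.univ.filter fun v => (∃ x, a v x) ∧ (v ∈ S ∨ ∃ u ∈ S, a u v)

open Classical in
/-- The set `W i` of common interventions of the skeleton class of `i` is enlarged by `v` if two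
entities of the class that look the same on `W i` have been seen to differ at `v`. -/
noncomputable def refineStep [Fintype V] (a : ι → V → V → Prop) (g : ι → V → Set V)
    (R : ι → Finset V) (S : Finset V) (v : V) (W : ι → Finset V) : ι → Finset V := fun i =>
  if v ∈ candidates (a i) S ∧ ∃ j j', a j = a i ∧ a j' = a i ∧ v ∈ R j ∧ v ∈ R j' ∧
      (∀ w ∈ W i, g j w = g j' w) ∧ g j v ≠ g j' v
  then insert v (W i) else W i

/-- The common interventions after all nodes of a list have been considered. -/
noncomputable def refineList [Fintype V] (a : ι → V → V → Prop) (g : ι → V → Set V)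
    (R : ι → Finset V) (S : Finset V) (l : List V) (W : ι → Finset V) : ι → Finset V :=
  l.foldl (fun W v => refineStep a g R S v W) W

/-- The graphs that are read off at the end: the children of `u` for the entity `i` are those that
the interventions on `u` of the entities with the same skeleton as `i`, and the same results on
`W i`, have shown. -/
def readOff (a : ι → V → V → Prop) (g : ι → V → Set V) (R : ι → Finset V) (W : ι → Finset V)
    (i : ι) : MixedGraph V :=
  let d : V → V → Prop := fun u v =>
    ∃ j, a j = a i ∧ (∀ w ∈ W i, g j w = g i w) ∧ u ∈ R j ∧ v ∈ g j u
  { dir := d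
    bi := fun u v => (a i u v ∨ a i v u) ∧ ¬ d u v ∧ ¬ d v u
    bi_symm := fun _ _ h => ⟨h.1.symm, h.2.2, h.2.1⟩ }

/-- `W` is constant on skeleton classes. -/
def IsClassFun (a : ι → V → V → Prop) (W : ι → Finset V) : Prop :=
  ∀ i j, a i = a j → W i = W j

variable {a : ι → V → V → Prop} {g g' : ι → V → Set V} {R W : ι → Finset V} {S : Finset V}

theorem readOff_congr (hW : IsClassFun a W)
    (hg : ∀ i v, v ∈ R i ∨ v ∈ W i → g' i v = g i v) : readOff a g' R W = readOff a g R W := by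
  have key : ∀ i u v, (∃ j, a j = a i ∧ (∀ w ∈ W i, g' j w = g' i w) ∧ u ∈ R j ∧ v ∈ g' j u) ↔
      ∃ j, a j = a i ∧ (∀ w ∈ W i, g j w = g i w) ∧ u ∈ R j ∧ v ∈ g j u := by
    refine fun i u v => exists_congr fun j => and_congr_right fun hj => and_congr
      (forall₂_congr fun w hw => ?_) (and_congr_right fun hu => ?_)
    · rw [hg j w (.inr (hW j i hj ▸ hw)), hg i w (.inr hw)]
    · rw [hg j u (.inl hu)]
  ext i u v
  · exact key i u v
  · exact and_congr_right fun _ => and_congr (not_congr (key i u v)) (not_congr (key i v u))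

variable [Fintype V]

theorem refineStep_congr (hW : IsClassFun a W) (hg : ∀ i v, v ∈ R i ∨ v ∈ W i → g' i v = g i v)
    (v : V) : refineStep a g' R S v W = refineStep a g R S v W := by
  funext i
  unfold refineStep
  congr 1
  refine propext (and_congr_right fun _ => exists₂_congr fun j j' => and_congr_right fun hj =>
    and_congr_right fun hj' => and_congr_right fun hv => and_congr_right fun hv' => and_congr
      (forall₂_congr fun w hw => ?_) ?_)
  · rw [hg j w (.inr (hW j i hj ▸ hw)), hg j' w (.inr (hW j' i hj' ▸ hw))]
  · rw [hg j v (.inl hv), hg j' v (.inl hv')]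

theorem IsClassFun.refineStep (hW : IsClassFun a W) (v : V) :
    IsClassFun a (refineStep a g R S v W) := by
  intro i j h
  unfold CollabCausal.refineStep
  rw [h, hW i j h]

theorem subset_refineStep (v : V) (i : ι) : W i ⊆ refineStep a g R S v W i := by
  classical
  unfold refineStep
  split_ifs
  · exact Finset.subset_insert _ _
  · exact subset_rfl

theorem IsClassFun.refineList (hW : IsClassFun a W) (l : List V) :
    IsClassFun a (refineList a g R S l W) := by
  induction l generalizing W with
  | nil => exact hW
  | cons v l ih => exact ih (hW.refineStep v)

theorem subset_refineList (l : List V) (i : ι) : W i ⊆ refineList a g R S l W i := by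
  induction l generalizing W with
  | nil => exact subset_rfl
  | cons v l ih => exact (subset_refineStep v i).trans (ih (W := refineStep a g R S v W))

theorem refineList_subset_candidates (l : List V) (i : ι) (hW : W i ⊆ candidates (a i) S) :
    refineList a g R S l W i ⊆ candidates (a i) S := by
  classical
  induction l generalizing W with
  | nil => exact hW
  | cons v l ih =>
    refine ih (W := refineStep a g R S v W) ?_
    unfold refineStep
    split_ifs with h
    · exact Finset.insert_subset h.1 hW
    · exact hW

/-- After the refinement, entities that have the same skeleton and look the same on the common
interventions are not seen to differ at any candidate. -/
theorem eq_of_agree_refineList {l : List V} {v : V} (hvl : v ∈ l) {i j j' : ι}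
    (hv : v ∈ candidates (a i) S) (hj : a j = a i) (hj' : a j' = a i) (hvj : v ∈ R j)
    (hvj' : v ∈ R j') (h : ∀ w ∈ refineList a g R S l W i, g j w = g j' w) :
    g j v = g j' v := by
  classical
  induction l generalizing W with
  | nil => simp at hvl
  | cons x l ih =>
    rcases List.mem_cons.1 hvl with rfl | hvl
    · by_contra hne
      have hin : v ∈ refineStep a g R S v W i := by
        unfold refineStep
        rw [if_pos ⟨hv, j, j', hj, hj', hvj, hvj', fun w hw =>
          h w (subset_refineList (v :: l) i hw), hne⟩]
        exact Finset.mem_insert_self _ _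
      exact hne (h v (subset_refineList (W := refineStep a g R S v W) l i hin))
    · exact ih (W := refineStep a g R S x W) hvl h

variable [Fintype ι]

open Classical in
/-- The results of the interventions on `W` within the skeleton class of `i`. -/
noncomputable def patterns (a : ι → V → V → Prop) (g : ι → V → Set V) (i : ι) (W : Finset V) :
    Finset (V → Set V) :=
  (Finset.univ.filter fun j => a j = a i).image fun j w => if w ∈ W then g j w else ∅

/-- Each enlargement of the set of common interventions splits a class of entities. -/
theorem card_add_one_le_card_patterns (l : List V) (i : ι)
    (hW : (W i).card + 1 ≤ (patterns a g i (W i)).card) :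
    (refineList a g R S l W i).card + 1 ≤ (patterns a g i (refineList a g R S l W i)).card := by
  classical
  induction l generalizing W with
  | nil => exact hW
  | cons v l ih =>
    refine ih (W := refineStep a g R S v W) ?_
    unfold refineStep
    split_ifs with h
    swap
    · exact hW
    obtain ⟨-, j, j', hj, hj', -, -, hagree, hne⟩ := h
    have hlt : (patterns a g i (W i)).card < (patterns a g i (insert v (W i))).card := by
      -- forgetting the result at `v` maps the new patterns onto the old ones, not injectively
      let f : (V → Set V) → V → Set V := fun h w => if w ∈ W i then h w else ∅
      have himg : patterns a g i (W i) = (patterns a g i (insert v (W i))).image f := by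
        unfold patterns
        rw [Finset.image_image]
        refine Finset.image_congr fun x _ => ?_
        funext w
        by_cases hw : w ∈ W i <;> simp [f, hw]
      rw [himg]
      refine lt_of_le_of_ne Finset.card_image_le fun heq => hne ?_
      have hinj := Finset.card_image_iff.1 heq
      have hmem : ∀ x, a x = a i → (fun w => if w ∈ insert v (W i) then g x w else ∅) ∈
          (patterns a g i (insert v (W i)) : Set (V → Set V)) := fun x hx =>
        Finset.mem_image.2 ⟨x, by simpa using hx, rfl⟩
      have := congrFun (hinj (hmem j hj) (hmem j' hj') (by
        funext w
        by_cases hw : w ∈ W i <;> simp [f, hw, hagree])) v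
      simpa using this
    have := Finset.card_insert_le v (W i)
    omega

theorem card_patterns_le [DecidableEq ι] (P : Finpartition (Finset.univ : Finset ι))
    (hP : ∀ B ∈ P.parts, ∀ i ∈ B, ∀ j ∈ B, g i = g j) (i : ι) (W : Finset V) :
    (patterns a g i W).card ≤ P.parts.card := by
  classical
  -- the common result of the members of a cluster
  let H : Finset ι → V → Set V := fun B w =>
    if h : ∃ j, j ∈ B then (if w ∈ W then g h.choose w else ∅) else ∅
  have : patterns a g i W ⊆ P.parts.image H := by
    intro f hf
    obtain ⟨j, -, rfl⟩ := Finset.mem_image.1 hf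
    obtain ⟨B, hB, hjB⟩ := P.exists_mem (Finset.mem_univ j)
    have hex : ∃ j, j ∈ B := ⟨j, hjB⟩
    refine Finset.mem_image.2 ⟨B, hB, ?_⟩
    funext w
    simp only [H, dif_pos hex, hP B hB _ hex.choose_spec j hjB]
  exact (Finset.card_le_card this).trans Finset.card_image_le

/-- The number of common interventions of an entity is less than the number of clusters. -/
theorem card_refineList_lt [DecidableEq ι] (P : Finpartition (Finset.univ : Finset ι))
    (hP : ∀ B ∈ P.parts, ∀ i ∈ B, ∀ j ∈ B, g i = g j) (l : List V) (i : ι) :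
    (refineList a g R S l (fun _ => ∅) i).card < P.parts.card := by
  classical
  refine lt_of_lt_of_le (Nat.lt_of_succ_le (card_add_one_le_card_patterns l i ?_))
    (card_patterns_le P hP i _)
  simp only [Finset.card_empty, zero_add, Nat.one_le_iff_ne_zero, ne_eq, Finset.card_eq_zero]
  exact Finset.Nonempty.ne_empty ⟨_, Finset.mem_image.2 ⟨i, by simp, rfl⟩⟩

/-- If `S` hits the differences of any two clusters, and if each cluster contains, for each node
that is not isolated, an entity intervened on it, then the refined classes are the clusters, and
the graphs read off are the true ones. -/
theorem readOff_refineList_eq [DecidableEq ι] {G : ι → MixedGraph V}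
    (hbi : ∀ i u v, (G i).bi u v ↔ (G i).Adj u v ∧ ¬ (G i).dir u v ∧ ¬ (G i).dir v u)
    (P : Finpartition (Finset.univ : Finset ι))
    (hP : ∀ B ∈ P.parts, ∀ i ∈ B, ∀ j ∈ B, G i = G j)
    (hS : ∀ i j, P.part i ≠ P.part j → (G i).Adj = (G j).Adj →
      ∃ u ∈ S, ∃ v, (G i).Adj u v ∧
        ((G i).children u ≠ (G j).children u ∨ (G i).children v ≠ (G j).children v))
    (hR : ∀ i v x, (G i).Adj v x → ∃ j ∈ P.part i, v ∈ R j) :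
    readOff (fun i => (G i).Adj) (fun i => (G i).children) R
      (refineList (fun i => (G i).Adj) (fun i => (G i).children) R S Finset.univ.toList
        fun _ => ∅) = G := by
  set a : ι → V → V → Prop := fun i => (G i).Adj with ha
  set g : ι → V → Set V := fun i => (G i).children with hg
  set W := refineList a g R S Finset.univ.toList fun _ => ∅ with hWdef
  have hpart : ∀ i, ∀ j ∈ P.part i, G j = G i := fun i j hj =>
    hP _ (P.part_mem.2 (Finset.mem_univ i)) j hj i (P.mem_part (Finset.mem_univ i))
  have hadjs : ∀ i u v, (G i).Adj u v → (G i).Adj v u := by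
    rintro i u v (h | h | h)
    · exact .inr (.inl h)
    · exact .inl h
    · exact .inr (.inr ((G i).bi_symm _ _ h))
  have hclass : ∀ i j, a j = a i → (∀ w ∈ W i, g j w = g i w) → G j = G i := by
    intro i j hji hW
    by_cases hij : P.part i = P.part j
    · exact hpart i j (hij ▸ P.mem_part (Finset.mem_univ j))
    exfalso
    obtain ⟨u, huS, v, huv, hne⟩ := hS i j hij hji.symm
    obtain ⟨x, y, hxy, hxS, hx⟩ : ∃ x y, a i x y ∧ (x ∈ S ∨ ∃ u ∈ S, a i u x) ∧ g i x ≠ g j x := by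
      rcases hne with h | h
      · exact ⟨u, v, huv, .inl huS, h⟩
      · exact ⟨v, u, hadjs i u v huv, .inr ⟨u, huS, huv⟩, h⟩
    obtain ⟨i', hi', hxi'⟩ := hR i x y hxy
    obtain ⟨j', hj', hxj'⟩ := hR j x y (by
      have h : a j x y := hji ▸ hxy
      exact h)
    have hGi := hpart i i' hi'
    have hGj := hpart j j' hj'
    have e1 : g i' = g i := by simp only [hg, hGi]
    have e2 : g j' = g j := by simp only [hg, hGj]
    have := eq_of_agree_refineList (a := a) (g := g) (R := R) (S := S) (W := fun _ => ∅)
      (l := Finset.univ.toList) (v := x) (by simp) (i := i) (j := i') (j' := j')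
      (by simp only [candidates, Finset.mem_filter, Finset.mem_univ, true_and]
          exact ⟨⟨y, hxy⟩, hxS⟩)
      (by simp only [ha, hGi]) (by simp only [ha, hGj]; exact hji) hxi' hxj'
      (fun w hw => by rw [e1, e2]; exact (hW w hw).symm)
    rw [e1, e2] at this
    exact hx this
  have hdir : ∀ i u v, (∃ j, a j = a i ∧ (∀ w ∈ W i, g j w = g i w) ∧ u ∈ R j ∧ v ∈ g j u) ↔
      (G i).dir u v := by
    refine fun i u v => ⟨?_, fun h => ?_⟩
    · rintro ⟨j, h1, h2, -, h4⟩
      have : (G j).dir u v := h4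
      rwa [hclass i j h1 h2] at this
    · obtain ⟨j, hj, huj⟩ := hR i u v (.inl h)
      have hGj := hpart i j hj
      exact ⟨j, by simp only [ha, hGj], by simp [hg, hGj], huj, by
        change (G j).dir u v
        rwa [hGj]⟩
  ext i u v
  · exact hdir i u v
  · rw [hbi]
    refine and_congr ⟨fun h => h.elim id (hadjs i v u), .inl⟩
      (and_congr (not_congr (hdir i u v)) (not_congr (hdir i v u)))

end Refine

/-! ### The algorithm -/

variable {V : Type*} {M : ℕ} {Out : Type*}

/-- A conditional independence test: the entity, the regime, the two nodes and the conditioning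
set. -/
abbrev CITest (V : Type*) (M : ℕ) : Type _ :=
  Fin M × Option V × V × V × Finset V

open Classical in
/-- The true answers to the tests. -/
noncomputable def trueAnswer [Fintype V] (E : Fin M → Entity V) (τ : CITest V M) : Bool :=
  decide ((E τ.1).CI τ.2.1 τ.2.2.1 τ.2.2.2.1 τ.2.2.2.2)

namespace Algorithm

open Classical in
/-- Perform all tests of a list and continue according to the answers, which are recorded in a
table. -/
noncomputable def ask : List (CITest V M) → (CITest V M → Bool) →
    ((CITest V M → Bool) → Algorithm V M Out) → Algorithm V M Out
  | [], ans, k => k ans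
  | τ :: l, ans, k => .test τ.1 τ.2.1 τ.2.2.1 τ.2.2.2.1 τ.2.2.2.2 fun b =>
      ask l (Function.update ans τ b) k

/-- Against the entities `E`, the algorithm deterministically outputs `o`, and it intervenes on the
entity `i` only on nodes of `B i`. -/
def Yields [Fintype V] (E : Fin M → Entity V) (A : Algorithm V M Out) (o : Out)
    (B : Fin M → Finset V) : Prop :=
  ∃ I : Fin M → Finset V, A.run E = PMF.pure (o, I) ∧ ∀ i, I i ⊆ B i

section Yields

variable [Fintype V] {E : Fin M → Entity V} {o : Out} {B : Fin M → Finset V}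

theorem yields_ret : (ret o : Algorithm V M Out).Yields E o B :=
  ⟨fun _ => ∅, rfl, fun _ => Finset.empty_subset _⟩

theorem yields_test {τ : CITest V M} {next : Bool → Algorithm V M Out}
    (h : (next (trueAnswer E τ)).Yields E o B) (hB : τ.2.1.toFinset ⊆ B τ.1) :
    (test τ.1 τ.2.1 τ.2.2.1 τ.2.2.2.1 τ.2.2.2.2 next).Yields E o B := by
  classical
  obtain ⟨I, hI, hIB⟩ := h
  refine ⟨Function.update I τ.1 (I τ.1 ∪ τ.2.1.toFinset), ?_, fun i => ?_⟩
  · rw [run]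
    unfold trueAnswer at hI
    rw [hI, PMF.pure_map]
  · by_cases hi : i = τ.1
    · subst hi
      rw [Function.update_self]
      exact Finset.union_subset (hIB _) hB
    · rw [Function.update_of_ne hi]
      exact hIB i

theorem yields_ask {l : List (CITest V M)} {ans : CITest V M → Bool}
    {k : (CITest V M → Bool) → Algorithm V M Out}
    (hB : ∀ τ ∈ l, τ.2.1.toFinset ⊆ B τ.1)
    (h : ∀ ans' : CITest V M → Bool, (∀ τ ∈ l, ans' τ = trueAnswer E τ) → (k ans').Yields E o B) :
    (ask l ans k).Yields E o B := by
  classical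
  suffices key : ∀ X : Set (CITest V M), (∀ τ ∈ X, ans τ = trueAnswer E τ) →
      (∀ ans' : CITest V M → Bool, (∀ τ, τ ∈ X ∨ τ ∈ l → ans' τ = trueAnswer E τ) →
        (k ans').Yields E o B) → (ask l ans k).Yields E o B from
    key ∅ (by simp) (by simpa using h)
  clear h
  induction l generalizing ans with
  | nil => exact fun X hX h => h ans fun τ hτ => hX τ (by simpa using hτ)
  | cons τ l ih =>
    intro X hX h
    refine yields_test (ih (fun σ hσ => hB σ (List.mem_cons_of_mem _ hσ)) (insert τ X) ?_ ?_)
      (hB τ List.mem_cons_self)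
    · intro σ hσ
      by_cases hστ : σ = τ
      · subst hστ
        convert Function.update_self ..
      · have := hX σ (hσ.resolve_left hστ)
        rw [← this]
        convert Function.update_of_ne hστ _ _
    · refine fun ans' h' => h ans' fun σ hσ => h' σ ?_
      rcases hσ with hσ | hσ
      · exact .inl (.inr hσ)
      · rcases List.mem_cons.1 hσ with rfl | hσ
        · exact .inl (.inl rfl)
        · exact .inr hσ

end Yields

/-- Draw a uniformly random element of a finite nonempty type and continue according to it. -/
noncomputable def uniform {Ω : Type*} [Fintype Ω] [Nonempty Ω] (next : Ω → Algorithm V M Out) :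
    Algorithm V M Out :=
  .sample (Fintype.card Ω - 1) fun j => next ((Fintype.equivFin Ω).symm
    (Fin.cast (Nat.sub_add_cancel Fintype.card_pos) j))

theorem uniform_run [Fintype V] {Ω : Type*} [Fintype Ω] [Nonempty Ω]
    {next : Ω → Algorithm V M Out} {E : Fin M → Entity V} {o : Ω → Out}
    {B : Ω → Fin M → Finset V} (h : ∀ x, (next x).Yields E (o x) (B x)) :
    (∀ ω ∈ ((uniform next).run E).support, ∃ x, ∀ i, ω.2 i ⊆ B x i) ∧
      ∀ (o' : Out) (T : Finset Ω) (p : ℝ), (∀ x ∈ T, o x = o') →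
        p * Fintype.card Ω ≤ T.card →
        ENNReal.ofReal p ≤ ((uniform next).run E).toOuterMeasure {ω | ω.1 = o'} := by
  classical
  choose I hI hIB using h
  have hm : Fintype.card Ω - 1 + 1 = Fintype.card Ω := Nat.sub_add_cancel Fintype.card_pos
  let e : Fin (Fintype.card Ω - 1 + 1) ≃ Ω := (finCongr hm).trans (Fintype.equivFin Ω).symm
  have hrun : (uniform next).run E =
      (PMF.uniformOfFintype (Fin (Fintype.card Ω - 1 + 1))).map fun j => (o (e j), I (e j)) := by
    rw [uniform, run, ← PMF.bind_pure_comp]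
    congr 1
    funext j
    exact hI (e j)
  rw [hrun]
  constructor
  · intro ω hω
    obtain ⟨j, -, rfl⟩ := (PMF.mem_support_map_iff _ _ _).1 hω
    exact ⟨e j, hIB (e j)⟩
  · intro o' T p hT hp
    rw [PMF.toOuterMeasure_map_apply, PMF.toOuterMeasure_uniformOfFintype_apply]
    have hcard : T.card ≤ Fintype.card ((fun j => (o (e j), I (e j))) ⁻¹'
        {ω : Out × (Fin M → Finset V) | ω.1 = o'}) := by
      rw [← Set.toFinset_card, ← Finset.card_map e.symm.toEmbedding]
      refine Finset.card_le_card fun j hj => ?_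
      obtain ⟨x, hx, rfl⟩ := Finset.mem_map.1 hj
      simpa using hT x hx
    have hcast : ((Fintype.card (Fin (Fintype.card Ω - 1 + 1)) : ℕ) : ENNReal) =
        (Fintype.card Ω : ℕ) := by
      rw [Fintype.card_fin, hm]
    rw [hcast]
    have hpos : (0 : ℝ) < Fintype.card Ω := by exact_mod_cast Fintype.card_pos
    have h1 : ENNReal.ofReal p ≤ ENNReal.ofReal (T.card / Fintype.card Ω) :=
      ENNReal.ofReal_le_ofReal ((le_div_iff₀ hpos).2 hp)
    refine h1.trans ?_
    rw [ENNReal.ofReal_div_of_pos hpos, ENNReal.ofReal_natCast, ENNReal.ofReal_natCast]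
    exact ENNReal.div_le_div_right (by exact_mod_cast hcard) _

end Algorithm

variable [Fintype V]

/-- The skeletons according to the answers to the observational tests. -/
def skeletonOf (ans : CITest V M → Bool) (i : Fin M) (u v : V) : Prop :=
  u ≠ v ∧ ∀ Z : Finset V, u ∉ Z → v ∉ Z → ans (i, none, u, v, Z) = false

/-- The children of `u` according to the answers to the tests under the intervention on `u`. -/
def childrenOf (a : Fin M → V → V → Prop) (ans : CITest V M → Bool) (i : Fin M) (u : V) : Set V :=
  {v | a i u v ∧ ans (i, some u, u, v, ∅) = false}

open Classical in
/-- All observational tests. -/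
noncomputable def observationalTests (V : Type*) [Fintype V] (M : ℕ) : List (CITest V M) :=
  (Finset.univ.filter fun τ : CITest V M => τ.2.1 = none).toList

open Classical in
/-- All tests under the interventions on the nodes of `Q i`, for each entity `i`. -/
noncomputable def interventionalTests (Q : Fin M → Finset V) : List (CITest V M) :=
  (Finset.univ.filter fun τ : CITest V M => ∃ w ∈ Q τ.1, τ.2.1 = some w).toList

open Classical in
/-- The refinement of the skeleton classes by adaptive interventions. In each round all tests under
the interventions made so far are repeated, which costs nothing, as only distinct interventions
count; so the sets `W i` are the only state that has to be carried along. -/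
noncomputable def refineAlgorithm (a : Fin M → V → V → Prop) (R : Fin M → Finset V)
    (S : Finset V) : List V → (Fin M → Finset V) → Algorithm V M (Fin M → MixedGraph V)
  | [], W => .ask (interventionalTests fun i => R i ∪ W i) (fun _ => false) fun ans =>
      .ret (readOff a (childrenOf a ans) R W)
  | v :: l, W => .ask (interventionalTests fun i => R i ∪ W i) (fun _ => false) fun ans =>
      refineAlgorithm a R S l (refineStep a (childrenOf a ans) R S v W)

open Classical in
/-- The nodes of `f i` that have a neighbour in the skeleton of `i`. -/
noncomputable def nonisolated (a : Fin M → V → V → Prop) (f : Fin M → Finset V) (i : Fin M) :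
    Finset V :=
  (f i).filter fun v => ∃ x, a i v x

/-- The algorithm for given random choices: the assignment `f` of nodes to the entities, and the
set `S` of test nodes. -/
noncomputable def learner (f : Fin M → Finset V) (S : Finset V) :
    Algorithm V M (Fin M → MixedGraph V) :=
  .ask (observationalTests V M) (fun _ => false) fun ans =>
    refineAlgorithm (skeletonOf ans) (nonisolated (skeletonOf ans) f) S Finset.univ.toList
      fun _ => ∅

section Semantics

variable {E : Fin M → Entity V}

theorem skeletonOf_eq (hM : ∀ i, (E i).IsMarkov) (hF : ∀ i, (E i).IsFaithful)
    {ans : CITest V M → Bool} (h : ∀ τ ∈ observationalTests V M, ans τ = trueAnswer E τ) :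
    skeletonOf ans = fun i => (E i).mag.Adj := by
  funext i u v
  rw [Entity.mag_adj_iff_ci (hM i) (hF i)]
  refine propext (and_congr_right fun _ => forall₃_congr fun Z _ _ => ?_)
  rw [h _ (by simp [observationalTests])]
  simp [trueAnswer]

theorem childrenOf_eq (hM : ∀ i, (E i).IsMarkov) (hF : ∀ i, (E i).IsFaithful)
    {ans : CITest V M → Bool} {Q : Fin M → Finset V}
    (h : ∀ τ ∈ interventionalTests Q, ans τ = trueAnswer E τ) {i : Fin M} {u : V} (hu : u ∈ Q i) :
    childrenOf (fun i => (E i).mag.Adj) ans i u = (E i).mag.children u := by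
  ext v
  rw [Entity.mem_children_mag_iff (hM i) (hF i)]
  refine and_congr_right fun _ => ?_
  rw [h _ (by simp [interventionalTests, hu])]
  simp [trueAnswer]

theorem refineAlgorithm_yields (hM : ∀ i, (E i).IsMarkov) (hF : ∀ i, (E i).IsFaithful)
    {R B : Fin M → Finset V} {S : Finset V} (l : List V) {W : Fin M → Finset V}
    (hW : IsClassFun (fun i => (E i).mag.Adj) W) (hRB : ∀ i, R i ⊆ B i)
    (hWB : ∀ i, refineList (fun i => (E i).mag.Adj) (fun i => (E i).mag.children) R S l W i ⊆ B i) :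
    (refineAlgorithm (fun i => (E i).mag.Adj) R S l W).Yields E
      (readOff (fun i => (E i).mag.Adj) (fun i => (E i).mag.children) R
        (refineList (fun i => (E i).mag.Adj) (fun i => (E i).mag.children) R S l W)) B := by
  classical
  induction l generalizing W with
  | nil =>
    rw [refineAlgorithm]
    refine Algorithm.yields_ask ?_ fun ans hans => ?_
    · intro τ hτ w hw
      simp only [interventionalTests, Finset.mem_toList, Finset.mem_filter] at hτ
      obtain ⟨-, x, hx, hτx⟩ := hτ
      simp only [hτx, Option.toFinset_some, Finset.mem_singleton] at hw
      subst hw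
      rcases Finset.mem_union.1 hx with hx | hx
      · exact hRB _ hx
      · exact hWB _ hx
    · rw [readOff_congr hW fun i v hv =>
        childrenOf_eq hM hF hans (Finset.mem_union.2 hv)]
      exact Algorithm.yields_ret
  | cons v l ih =>
    rw [refineAlgorithm]
    refine Algorithm.yields_ask ?_ fun ans hans => ?_
    · intro τ hτ w hw
      simp only [interventionalTests, Finset.mem_toList, Finset.mem_filter] at hτ
      obtain ⟨-, x, hx, hτx⟩ := hτ
      simp only [hτx, Option.toFinset_some, Finset.mem_singleton] at hw
      subst hw
      rcases Finset.mem_union.1 hx with hx | hx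
      · exact hRB _ hx
      · exact hWB _ (subset_refineList _ _ hx)
    · rw [refineStep_congr hW fun i v hv =>
        childrenOf_eq hM hF hans (Finset.mem_union.2 hv)]
      exact ih (hW.refineStep v) hWB

open Classical in
theorem learner_yields (hM : ∀ i, (E i).IsMarkov) (hF : ∀ i, (E i).IsFaithful)
    (f : Fin M → Finset V) (S : Finset V) :
    (learner f S).Yields E
      (readOff (fun i => (E i).mag.Adj) (fun i => (E i).mag.children)
        (nonisolated (fun i => (E i).mag.Adj) f)
        (refineList (fun i => (E i).mag.Adj) (fun i => (E i).mag.children)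
          (nonisolated (fun i => (E i).mag.Adj) f) S Finset.univ.toList fun _ => ∅))
      (fun i => nonisolated (fun i => (E i).mag.Adj) f i ∪
        refineList (fun i => (E i).mag.Adj) (fun i => (E i).mag.children)
          (nonisolated (fun i => (E i).mag.Adj) f) S Finset.univ.toList (fun _ => ∅) i) := by
  refine Algorithm.yields_ask ?_ fun ans hans => ?_
  · intro τ hτ
    simp only [observationalTests, Finset.mem_toList, Finset.mem_filter] at hτ
    simp [hτ.2]
  · rw [skeletonOf_eq hM hF hans]
    exact refineAlgorithm_yields hM hF _ (fun _ _ _ => rfl) (fun _ => Finset.subset_union_left)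
      fun _ => Finset.subset_union_right

end Semantics

/-! ### Counting bad random choices -/

/-- Of the functions from `κ` to `V`, at most a proportion `exp (-|J| |U| / |V|)` maps no element
of `J` to `U`. -/
theorem card_filter_avoid_le {κ V : Type*} [Fintype κ] [DecidableEq κ] [Fintype V] [Nonempty V]
    [DecidableEq V] (J : Finset κ) (U : Finset V) :
    ((Finset.univ.filter fun ω : κ → V => ∀ x ∈ J, ω x ∉ U).card : ℝ) ≤
      Real.exp (-(J.card * U.card / Fintype.card V)) * Fintype.card (κ → V) := by
  have hset : (Finset.univ.filter fun ω : κ → V => ∀ x ∈ J, ω x ∉ U) =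
      Fintype.piFinset fun x => if x ∈ J then Uᶜ else Finset.univ := by
    ext ω
    simp only [Finset.mem_filter, Finset.mem_univ, true_and, Fintype.mem_piFinset]
    refine forall_congr' fun x => ?_
    by_cases hx : x ∈ J <;> simp [hx]
  have hn : (0 : ℝ) < Fintype.card V := by exact_mod_cast Fintype.card_pos
  rw [hset, Fintype.card_piFinset, Nat.cast_prod]
  calc ∏ x, (((if x ∈ J then Uᶜ else Finset.univ : Finset V).card : ℕ) : ℝ)
      ≤ ∏ x, ((if x ∈ J then Real.exp (-(U.card / Fintype.card V)) else 1) *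
          (Fintype.card V : ℝ)) := by
        refine Finset.prod_le_prod (fun _ _ => Nat.cast_nonneg _) fun x _ => ?_
        by_cases hx : x ∈ J
        · rw [if_pos hx, if_pos hx, Finset.card_compl, Nat.cast_sub (Finset.card_le_univ U)]
          have := mul_le_mul_of_nonneg_right
            (Real.one_sub_le_exp_neg ((U.card : ℝ) / Fintype.card V)) hn.le
          rwa [sub_mul, one_mul, div_mul_cancel₀ _ hn.ne'] at this
        · rw [if_neg hx, if_neg hx, one_mul, Finset.card_univ]
    _ = Real.exp (-(J.card * U.card / Fintype.card V)) * Fintype.card (κ → V) := by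
        rw [Finset.prod_mul_distrib, Finset.prod_ite_mem, Finset.univ_inter, Finset.prod_const,
          Finset.prod_const, ← Real.exp_nat_mul, Fintype.card_fun, Finset.card_univ, Nat.cast_pow]
        congr 2
        ring

/-- With probability at least `1 - δ`, the last `s` random nodes hit all the sets `D i j`, for `i`
and `j` in different clusters, and each node is assigned to an entity of each cluster. -/
theorem card_good_ge {V : Type*} [Fintype V] [Nonempty V] [DecidableEq V] {M : ℕ} {c α δ : ℝ}
    {r s t : ℕ} (hc : 0 < c) (hδ : 0 < δ) (hδ1 : δ < 1) (hM : 0 < M)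
    (hMδ : 2 ≤ M / δ) (hr : (1 / 2 : ℝ) ^ r ≤ c * Real.log 2)
    (hs : 3 * Real.log (M / δ) ≤ α * s) (ht : (3 + r : ℝ) ≤ c * t)
    (P : Finpartition (Finset.univ : Finset (Fin M)))
    (hP : ∀ B ∈ P.parts, c * (Fintype.card V * Real.log (M / δ)) ≤ (B.card : ℝ))
    (D : Fin M → Fin M → Finset V)
    (hD : ∀ i j, P.part i ≠ P.part j → α * Fintype.card V ≤ (D i j).card) :
    (1 - δ) * Fintype.card ((Fin M × Fin t) ⊕ Fin s → V) ≤
      ((Finset.univ.filter fun ω : (Fin M × Fin t) ⊕ Fin s → V =>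
        (∀ i j, P.part i ≠ P.part j → ∃ σ, ω (.inr σ) ∈ D i j) ∧
          ∀ i v, ∃ j ∈ P.part i, ∃ τ, ω (.inl (j, τ)) = v).card : ℝ) := by
  set L := Real.log (M / δ) with hLdef
  set q := δ / M with hq
  set N := (Fintype.card ((Fin M × Fin t) ⊕ Fin s → V) : ℝ) with hN
  set good := Finset.univ.filter fun ω : (Fin M × Fin t) ⊕ Fin s → V =>
        (∀ i j, P.part i ≠ P.part j → ∃ σ, ω (.inr σ) ∈ D i j) ∧
          ∀ i v, ∃ j ∈ P.part i, ∃ τ, ω (.inl (j, τ)) = v with hgood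
  have hM0 : (0 : ℝ) < M := by exact_mod_cast hM
  have hn : (0 : ℝ) < Fintype.card V := by exact_mod_cast Fintype.card_pos
  have hlog2 : 0 < Real.log 2 := Real.log_pos (by norm_num)
  have hL2 : Real.log 2 ≤ L := Real.log_le_log (by norm_num) hMδ
  have hL : 0 < L := hlog2.trans_le hL2
  have hq0 : 0 < q := div_pos hδ hM0
  have hexp : Real.exp (-L) = q := by
    rw [Real.exp_neg, hLdef, Real.exp_log (by positivity), hq, inv_div]
  have hq2 : q ≤ 1 / 2 := by
    rw [hq, div_le_iff₀ hM0]
    rw [le_div_iff₀ hδ] at hMδ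
    linarith
  have hMq : M * q = δ := by rw [hq]; field_simp
  have hsmall : (M : ℝ) ^ 2 * q ^ 3 ≤ δ / 2 := by
    have : (M : ℝ) ^ 2 * q ^ 3 = δ * δ * q := by rw [← hMq]; ring
    rw [this]
    have h1 : δ * δ ≤ δ * 1 := mul_le_mul_of_nonneg_left hδ1.le hδ.le
    calc δ * δ * q ≤ (δ * 1) * (1 / 2) := mul_le_mul h1 hq2 hq0.le (by linarith)
      _ = δ / 2 := by ring
  have hN0 : 0 ≤ N := Nat.cast_nonneg _
  let bad₁ : Fin M × Fin M → Finset ((Fin M × Fin t) ⊕ Fin s → V) := fun x =>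
    if P.part x.1 ≠ P.part x.2 then Finset.univ.filter fun ω =>
      ∀ y ∈ (Finset.univ : Finset (Fin s)).map (⟨.inr, Sum.inr_injective⟩ :
        Fin s ↪ (Fin M × Fin t) ⊕ Fin s), ω y ∉ D x.1 x.2 else ∅
  let bad₂ : Fin M × V → Finset ((Fin M × Fin t) ⊕ Fin s → V) := fun x =>
    Finset.univ.filter fun ω =>
      ∀ y ∈ (P.part x.1 ×ˢ (Finset.univ : Finset (Fin t))).map (⟨.inl, Sum.inl_injective⟩ :
        Fin M × Fin t ↪ (Fin M × Fin t) ⊕ Fin s), ω y ∉ ({x.2} : Finset V)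
  have h₁ : ∀ x, ((bad₁ x).card : ℝ) ≤ q ^ 3 * N := by
    intro x
    by_cases hx : P.part x.1 ≠ P.part x.2
    · simp only [bad₁, if_pos hx]
      refine (card_filter_avoid_le _ _).trans ?_
      refine mul_le_mul_of_nonneg_right ?_ hN0
      rw [← hexp, ← Real.exp_nat_mul, Real.exp_le_exp, Finset.card_map, Finset.card_univ,
        Fintype.card_fin]
      have : α ≤ (D x.1 x.2).card / Fintype.card V := (le_div_iff₀ hn).2 (hD _ _ hx)
      have := mul_le_mul_of_nonneg_left this (Nat.cast_nonneg s)
      rw [mul_div_assoc]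
      push_cast
      linarith
    · simp only [bad₁, if_neg hx, Finset.card_empty, Nat.cast_zero]
      positivity
  have h₂ : ∀ x, ((bad₂ x).card : ℝ) ≤ q ^ 3 * (c * Real.log 2) * N := by
    intro x
    refine (card_filter_avoid_le _ _).trans ?_
    refine mul_le_mul_of_nonneg_right ?_ hN0
    have hqr : q ^ (3 + r) ≤ q ^ 3 * (c * Real.log 2) := by
      rw [pow_add]
      exact mul_le_mul_of_nonneg_left ((pow_le_pow_left₀ hq0.le hq2 r).trans hr) (by positivity)
    refine le_trans ?_ hqr
    rw [← hexp, ← Real.exp_nat_mul, Real.exp_le_exp, Finset.card_map, Finset.card_product,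
      Finset.card_univ, Fintype.card_fin, Finset.card_singleton]
    have hB := hP _ (P.part_mem.2 (Finset.mem_univ x.1))
    have hB' : c * L ≤ (P.part x.1).card / Fintype.card V := by
      rw [le_div_iff₀ hn]
      linarith
    have h3 := mul_le_mul_of_nonneg_left hB' (Nat.cast_nonneg t)
    have h4 := mul_le_mul_of_nonneg_right ht hL.le
    have h5 : ((((P.part x.1).card * t : ℕ) : ℝ) * ((1 : ℕ) : ℝ) / Fintype.card V) =
        t * ((P.part x.1).card / Fintype.card V) := by
      push_cast
      ring
    rw [h5]
    push_cast
    linarith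
  have hcover : (Finset.univ : Finset ((Fin M × Fin t) ⊕ Fin s → V)) ⊆
      good ∪ (Finset.univ.biUnion bad₁ ∪ Finset.univ.biUnion bad₂) := by
    intro ω _
    by_contra hω
    simp only [Finset.mem_union, Finset.mem_biUnion, Finset.mem_univ, true_and, not_or,
      not_exists] at hω
    obtain ⟨hg, hb₁, hb₂⟩ := hω
    refine hg ?_
    rw [hgood, Finset.mem_filter]
    refine ⟨Finset.mem_univ _, fun i j hij => ?_, fun i v => ?_⟩
    · by_contra! h
      refine hb₁ (i, j) ?_
      simp only [bad₁, if_pos hij]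
      simpa using h
    · by_contra! h
      refine hb₂ (i, v) (Finset.mem_filter.2 ⟨Finset.mem_univ _, fun y hy => ?_⟩)
      obtain ⟨⟨j, τ⟩, hjτ, rfl⟩ := Finset.mem_map.1 hy
      simpa using h j (Finset.mem_product.1 hjτ).1 τ
  have hcard : N ≤ good.card + (M * M * (q ^ 3 * N) +
      M * Fintype.card V * (q ^ 3 * (c * Real.log 2) * N)) := by
    have e0 := Finset.card_le_card hcover
    have e1 := Finset.card_union_le good (Finset.univ.biUnion bad₁ ∪ Finset.univ.biUnion bad₂)
    have e2 := Finset.card_union_le (Finset.univ.biUnion bad₁) (Finset.univ.biUnion bad₂)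
    have e3 := Finset.card_biUnion_le (s := Finset.univ) (t := bad₁)
    have e4 := Finset.card_biUnion_le (s := Finset.univ) (t := bad₂)
    have e5 : N ≤ good.card + ((∑ x, (bad₁ x).card : ℕ) + (∑ x, (bad₂ x).card : ℕ)) := by
      rw [hN, ← Finset.card_univ]
      exact_mod_cast e0.trans (e1.trans (by omega))
    refine e5.trans (add_le_add le_rfl (add_le_add ?_ ?_))
    · rw [Nat.cast_sum]
      refine (Finset.sum_le_sum fun x _ => h₁ x).trans (le_of_eq ?_)
      simp
    · rw [Nat.cast_sum]
      refine (Finset.sum_le_sum fun x _ => h₂ x).trans (le_of_eq ?_)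
      simp
  -- a cluster has at most `M` members, which bounds the number of nodes
  have hnM : c * Real.log 2 * Fintype.card V ≤ M := by
    have hB := hP _ (P.part_mem.2 (Finset.mem_univ ⟨0, hM⟩))
    have h1 : ((P.part ⟨0, hM⟩).card : ℝ) ≤ M := by
      have := Finset.card_le_univ (P.part ⟨0, hM⟩)
      rw [Fintype.card_fin] at this
      exact_mod_cast this
    have h2 : c * (Fintype.card V * Real.log 2) ≤ c * (Fintype.card V * L) := by gcongr
    linarith
  have hfin : M * Fintype.card V * (q ^ 3 * (c * Real.log 2) * N) ≤ δ / 2 * N := by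
    calc M * Fintype.card V * (q ^ 3 * (c * Real.log 2) * N)
        = (M * q ^ 3 * N) * (c * Real.log 2 * Fintype.card V) := by ring
      _ ≤ (M * q ^ 3 * N) * M := mul_le_mul_of_nonneg_left hnM (by positivity)
      _ = (M ^ 2 * q ^ 3) * N := by ring
      _ ≤ δ / 2 * N := mul_le_mul_of_nonneg_right hsmall hN0
  have hfin' : M * M * (q ^ 3 * N) ≤ δ / 2 * N := by
    have := mul_le_mul_of_nonneg_right hsmall hN0
    linarith
  linarith

/-! ### Degrees and node differences -/

instance : Finite EdgeType :=
  Finite.of_surjective (fun x : Fin 3 => match x with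
    | 0 => EdgeType.tail
    | 1 => EdgeType.head
    | 2 => EdgeType.bidirected) (by
    rintro (_ | _ | _)
    exacts [⟨0, rfl⟩, ⟨1, rfl⟩, ⟨2, rfl⟩])

theorem ncard_setOf_adj_le (G : Fin M → MixedGraph V) (i : Fin M) (u : V) :
    {v | (G i).Adj u v}.ncard ≤ maxDegree G := by
  have h1 : {v | (G i).Adj u v} ⊆ Prod.fst '' (G i).incidence u := by
    rintro v (h | h | h)
    · exact ⟨(v, .tail), .inl ⟨rfl, h⟩, rfl⟩
    · exact ⟨(v, .head), .inr (.inl ⟨rfl, h⟩), rfl⟩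
    · exact ⟨(v, .bidirected), .inr (.inr ⟨rfl, h⟩), rfl⟩
  refine (Set.ncard_le_ncard h1 (Set.toFinite _)).trans
    ((Set.ncard_image_le (Set.toFinite _)).trans ?_)
  exact (Finset.le_sup (f := fun u => ((G i).incidence u).ncard) (Finset.mem_univ u)).trans
    (Finset.le_sup (f := fun i => Finset.univ.sup fun u => ((G i).incidence u).ncard)
      (Finset.mem_univ i))

theorem one_le_maxDegree {G : Fin M → MixedGraph V} {i : Fin M} {u v : V} (h : (G i).Adj u v) :
    1 ≤ maxDegree G := by
  refine le_trans ?_ (ncard_setOf_adj_le G i u)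
  exact (Set.ncard_pos (Set.toFinite _)).2 ⟨v, h⟩

theorem card_candidates_le (G : Fin M → MixedGraph V) (i : Fin M) (S : Finset V) :
    (candidates (G i).Adj S).card ≤ 2 * maxDegree G * S.card := by
  classical
  rcases (candidates (G i).Adj S).eq_empty_or_nonempty with h | ⟨v, hv⟩
  · simp [h]
  obtain ⟨x, hx⟩ := (Finset.mem_filter.1 hv).2.1
  have hΔ := one_le_maxDegree hx
  have hsub : candidates (G i).Adj S ⊆
      S ∪ S.biUnion fun u => Finset.univ.filter fun v => (G i).Adj u v := by
    intro w hw
    rcases (Finset.mem_filter.1 hw).2.2 with h | ⟨u, hu, huw⟩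
    · exact Finset.mem_union_left _ h
    · exact Finset.mem_union_right _ (Finset.mem_biUnion.2 ⟨u, hu, by simpa using huw⟩)
  have h1 := (Finset.card_le_card hsub).trans (Finset.card_union_le _ _)
  have h2 := Finset.card_biUnion_le_card_mul S
    (fun u => Finset.univ.filter fun v => (G i).Adj u v) (maxDegree G) fun u _ => by
      refine le_trans (le_of_eq ?_) (ncard_setOf_adj_le G i u)
      rw [← Set.ncard_coe_finset]
      simp
  nlinarith

/-- If two graphs with the same skeleton differ at `u`, then one of the edges at `u` is seen to
differ by the interventions on its endpoints. -/
theorem exists_children_ne {V : Type*} {G H : MixedGraph V}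
    (hG : ∀ u v, G.bi u v ↔ G.Adj u v ∧ ¬ G.dir u v ∧ ¬ G.dir v u)
    (hH : ∀ u v, H.bi u v ↔ H.Adj u v ∧ ¬ H.dir u v ∧ ¬ H.dir v u) (hadj : G.Adj = H.Adj) {u : V}
    (hu : u ∈ G.nodeDiff H) :
    ∃ v, G.Adj u v ∧ (G.children u ≠ H.children u ∨ G.children v ≠ H.children v) := by
  by_contra! h
  refine hu ?_
  have key : ∀ v, (G.dir u v ↔ H.dir u v) ∧ (G.dir v u ↔ H.dir v u) ∧ (G.bi u v ↔ H.bi u v) := by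
    intro v
    have hadj' : G.Adj u v ↔ H.Adj u v := by rw [hadj]
    by_cases huv : G.Adj u v
    · obtain ⟨h1, h2⟩ := h v huv
      have e1 : G.dir u v ↔ H.dir u v := Set.ext_iff.1 h1 v
      have e2 : G.dir v u ↔ H.dir v u := Set.ext_iff.1 h2 u
      exact ⟨e1, e2, by rw [hG, hH, e1, e2, hadj']⟩
    · have huv' := mt hadj'.2 huv
      unfold MixedGraph.Adj at huv huv'
      tauto
  ext ⟨v, e⟩
  obtain ⟨h1, h2, h3⟩ := key v
  simp only [MixedGraph.incidence, Set.mem_ofPred_eq, h1, h2, h3]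

theorem eq_of_nodeDist_eq_zero {G H : MixedGraph V} (h : G.nodeDist H = 0) : G = H := by
  have h0 : G.nodeDiff H = ∅ := (Set.ncard_eq_zero (Set.toFinite _)).1 h
  have hinc : ∀ u, G.incidence u = H.incidence u := fun u => by
    by_contra hu
    exact (Set.eq_empty_iff_forall_notMem.1 h0 u) hu
  ext u v
  · simpa [MixedGraph.incidence] using Set.ext_iff.1 (hinc u) (v, .tail)
  · simpa [MixedGraph.incidence] using Set.ext_iff.1 (hinc u) (v, .bidirected)

/-! ### The number of interventions -/

/-- The two bounds on the number of interventions: `x` counts the assigned nodes, `y` the common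
interventions, `d` is the maximum degree, `k` the number of clusters, and `l = log (M / δ) / α`. -/
theorem intervention_count_le {x y d k s t : ℕ} {l : ℝ} (hl : 1 / 2 ≤ l) (hs : s ≤ 3 * l + 1)
    (hx : x ≤ t) (hxd : x ≠ 0 → 1 ≤ d) (hy : y ≤ 2 * d * s) (hyk : y < k) :
    ((x + y : ℕ) : ℝ) ≤ min ((2 * t + 10) * (d * l)) ((2 * t + 10) * (l + (k : ℝ) ^ 2)) := by
  have hx' : (x : ℝ) ≤ t := by exact_mod_cast hx
  have ht : (t : ℝ) ≤ 2 * t * l := by nlinarith [(Nat.cast_nonneg t : (0 : ℝ) ≤ t)]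
  have ht0 : (0 : ℝ) ≤ t := Nat.cast_nonneg t
  have hd0 : (0 : ℝ) ≤ d := Nat.cast_nonneg d
  push_cast
  refine le_min ?_ ?_
  · have h1 : (x : ℝ) ≤ 2 * t * (d * l) := by
      rcases Nat.eq_zero_or_pos x with h0 | h0
      · rw [h0, Nat.cast_zero]
        positivity
      · have hd : (1 : ℝ) ≤ d := by exact_mod_cast hxd h0.ne'
        have : 2 * t * l * 1 ≤ 2 * t * l * d := mul_le_mul_of_nonneg_left hd (by positivity)
        linarith
    have h2 : (y : ℝ) ≤ 10 * (d * l) := by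
      have h3 : (y : ℝ) ≤ 2 * d * s := by exact_mod_cast hy
      have h4 : (2 * d * s : ℝ) ≤ 2 * d * (5 * l) :=
        mul_le_mul_of_nonneg_left (by linarith) (by positivity)
      linarith
    linarith
  · have h1 : (y : ℝ) ≤ (k : ℝ) ^ 2 := by
      have : y ≤ k ^ 2 := by nlinarith
      exact_mod_cast this
    have h2 : 0 ≤ (k : ℝ) ^ 2 := sq_nonneg _
    nlinarith

end CollabCausal

theorem theorem2 (c : ℝ) (hc : 0 < c) :
    ∃ C : ℝ, 0 < C ∧
      ∀ (V : Type*) [Fintype V] (M : ℕ) (α δ : ℝ),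
        0 < α → α ≤ 1 → 0 < δ → δ < 1 → (2 ≤ M ∨ δ ≤ 1 / 2) →
        ∃ A : Algorithm V M (Fin M → MixedGraph V),
          ∀ (E : Fin M → Entity V) (P : Finpartition (Finset.univ : Finset (Fin M))),
            (∀ i, (E i).IsMarkov) → (∀ i, (E i).IsFaithful) →
            IsClustering (fun i => (E i).mag) α P →
            (∀ B ∈ P.parts, c * (Fintype.card V * Real.log (M / δ)) ≤ (B.card : ℝ)) →
            ENNReal.ofReal (1 - δ) ≤
                (A.run E).toOuterMeasure {ω | ω.1 = fun i => (E i).mag} ∧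
              ∀ ω ∈ (A.run E).support, ∀ i : Fin M,
                ((ω.2 i).card : ℝ) ≤
                  min (C * (maxDegree (fun i => (E i).mag) * Real.log (M / δ) / α))
                    (C * (Real.log (M / δ) / α + (P.parts.card : ℝ) ^ 2)) := by
  have hlog2 : 0 < Real.log 2 := Real.log_pos (by norm_num)
  have hlog2' : 1 / 2 ≤ Real.log 2 := by linarith [Real.log_two_gt_d9]
  -- `r` absorbs the factor `1 / c` in the bound on the number of pairs of a node and a cluster,
  -- and `t` is the number of nodes that are assigned to each entity
  obtain ⟨r, hr⟩ := exists_pow_lt_of_lt_one (mul_pos hc hlog2) (by norm_num : (1 / 2 : ℝ) < 1)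
  obtain ⟨t, ht⟩ := exists_nat_ge ((3 + r : ℝ) / c)
  rw [div_le_iff₀ hc] at ht
  refine ⟨2 * t + 10, by positivity, ?_⟩
  intro V _ M α δ hα hα1 hδ hδ1 hMδ
  classical
  rcases Nat.eq_zero_or_pos M with rfl | hM
  · -- without entities there is nothing to learn
    refine ⟨.ret Fin.elim0, fun E P _ _ _ _ => ⟨?_, fun _ _ i => i.elim0⟩⟩
    have hset : {ω : (Fin 0 → MixedGraph V) × (Fin 0 → Finset V) | ω.1 = fun i => (E i).mag} =
        Set.univ := Set.eq_univ_of_forall fun ω => Subsingleton.elim _ _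
    rw [hset, (PMF.toOuterMeasure_apply_eq_one_iff _ _).2 (Set.subset_univ _)]
    exact ENNReal.ofReal_le_one.2 (by linarith)
  have hM0 : (0 : ℝ) < M := by exact_mod_cast hM
  have hratio : 2 ≤ M / δ := by
    rw [le_div_iff₀ hδ]
    rcases hMδ with h | h
    · have : (2 : ℝ) ≤ M := by exact_mod_cast h
      linarith
    · have : (1 : ℝ) ≤ M := by exact_mod_cast hM
      linarith
  have hL : 1 / 2 ≤ Real.log (M / δ) :=
    hlog2'.trans (Real.log_le_log (by norm_num) hratio)
  have hl : 1 / 2 ≤ Real.log (M / δ) / α := by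
    rw [le_div_iff₀ hα]
    linarith
  rcases isEmpty_or_nonempty V with hV | hV
  · -- without nodes there is nothing to learn
    refine ⟨.ret fun _ => ⟨fun _ _ => False, fun _ _ => False, fun _ _ => id⟩,
      fun E P _ _ _ _ => ⟨?_, fun ω _ i => ?_⟩⟩
    · have hsub : Subsingleton (MixedGraph V) :=
        ⟨fun G H => by ext u; exacts [hV.elim u, hV.elim u]⟩
      have hset : {ω : (Fin M → MixedGraph V) × (Fin M → Finset V) | ω.1 = fun i => (E i).mag} =
          Set.univ := Set.eq_univ_of_forall fun ω => Subsingleton.elim _ _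
      rw [hset, (PMF.toOuterMeasure_apply_eq_one_iff _ _).2 (Set.subset_univ _)]
      exact ENNReal.ofReal_le_one.2 (by linarith)
    · rw [Finset.eq_empty_of_isEmpty (ω.2 i), Finset.card_empty, Nat.cast_zero]
      have : 0 ≤ Real.log (M / δ) := by linarith
      exact le_min (by positivity) (by positivity)
  -- `s` test nodes make the exponent `3` beat the number `M ^ 2` of pairs of entities
  obtain ⟨s, hs3, hs⟩ : ∃ s : ℕ, 3 * (Real.log (M / δ) / α) ≤ s ∧
      (s : ℝ) ≤ 3 * (Real.log (M / δ) / α) + 1 :=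
    ⟨⌈3 * (Real.log (M / δ) / α)⌉₊, Nat.le_ceil _, (Nat.ceil_lt_add_one (by linarith)).le⟩
  let f : ((Fin M × Fin t) ⊕ Fin s → V) → Fin M → Finset V := fun ω i =>
    Finset.univ.image fun τ => ω (.inl (i, τ))
  let S : ((Fin M × Fin t) ⊕ Fin s → V) → Finset V := fun ω =>
    Finset.univ.image fun σ => ω (.inr σ)
  refine ⟨.uniform fun ω => learner (f ω) (S ω), fun E P hMk hF hcl hB => ?_⟩
  obtain ⟨-, -, hsame, hdiff⟩ := hcl
  obtain ⟨hsupp, hprob⟩ := Algorithm.uniform_run fun ω => learner_yields hMk hF (f ω) (S ω)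
  have hP : ∀ B ∈ P.parts, ∀ i ∈ B, ∀ j ∈ B, (E i).mag = (E j).mag := fun B hBP i hi j hj => by
    have := hsame B hBP i hi j hj
    rw [zero_mul] at this
    exact eq_of_nodeDist_eq_zero (by exact_mod_cast this.antisymm (Nat.cast_nonneg _))
  constructor
  · refine hprob _ _ _ (fun ω hω => ?_) (card_good_ge (α := α) (t := t) (s := s) hc hδ hδ1
      hM hratio hr.le
      ?_ (by linarith) P hB
      (fun i j => Finset.univ.filter fun u => u ∈ (E i).mag.nodeDiff (E j).mag) fun i j hij => ?_)
    · obtain ⟨-, hS, hR⟩ := Finset.mem_filter.1 hω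
      refine readOff_refineList_eq (G := fun i => (E i).mag) (fun i => (E i).mag_bi_iff) P hP
        (fun i j hij hadj => ?_) fun i v x hvx => ?_
      · obtain ⟨σ, hσ⟩ := hS i j hij
        exact ⟨ω (.inr σ), Finset.mem_image_of_mem _ (Finset.mem_univ σ),
          exists_children_ne (E i).mag_bi_iff (E j).mag_bi_iff hadj (Finset.mem_filter.1 hσ).2⟩
      · obtain ⟨j, hj, τ, rfl⟩ := hR i v
        refine ⟨j, hj, Finset.mem_filter.2 ⟨Finset.mem_image_of_mem _ (Finset.mem_univ τ), x, ?_⟩⟩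
        change (E j).mag.Adj _ _
        rwa [hP _ (P.part_mem.2 (Finset.mem_univ i)) j hj i (P.mem_part (Finset.mem_univ i))]
    · rw [mul_div_assoc', div_le_iff₀ hα] at hs3
      linarith
    · have := hdiff _ (P.part_mem.2 (Finset.mem_univ i)) _ (P.part_mem.2 (Finset.mem_univ j)) hij i
        (P.mem_part (Finset.mem_univ i)) j (P.mem_part (Finset.mem_univ j))
      refine this.trans (le_of_eq ?_)
      rw [MixedGraph.nodeDist, ← Set.ncard_coe_finset]
      simp
  · intro ω hω i
    obtain ⟨x, hx⟩ := hsupp ω hω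
    have hcard := (Finset.card_le_card (hx i)).trans (Finset.card_union_le _ _)
    rw [mul_div_assoc]
    refine le_trans (by exact_mod_cast hcard) (intervention_count_le hl hs (x := _) (y := _)
      ?_ ?_ ?_ (card_refineList_lt P (fun B hBP i hi j hj => ?_) _ i))
    · refine (Finset.card_filter_le _ _).trans (Finset.card_image_le.trans ?_)
      simp
    · intro h0
      obtain ⟨v, hv⟩ := Finset.card_ne_zero.1 h0
      obtain ⟨-, y, hy⟩ := Finset.mem_filter.1 hv
      exact one_le_maxDegree (G := fun i => (E i).mag) hy
    · refine (Finset.card_le_card (refineList_subset_candidates _ i (Finset.empty_subset _))).trans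
        ((card_candidates_le (fun i => (E i).mag) i _).trans (Nat.mul_le_mul_left _ ?_))
      refine Finset.card_image_le.trans ?_
      simp
    · rw [hP B hBP i hi j hj]
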